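/- Let $E_0,E_1$ be (real or complex) Banach spaces with $E_1$ densely and continuously embedded in $E_0$. For $\theta\in(0,1)$ let $E_\theta:=(E_0,E_1)^0_{\theta,\infty}$ be the continuous interpolation space, i.e. the set of $x\in E_0$ with $\lim_{t\to0+}t^{-\theta}K(t,x)=0$, where $K(t,x)=\inf_{y\in E_1}(|x-y|_{E_0}+t|y|_{E_1})$, with norm $|x|_{E_\theta}=\sup_{t>0}t^{-\theta}K(t,x)$. Fix $\mu\in(0,1)$. For $T>0$ and a Banach space $E$, let $BC_{1-\mu}([0,T],E)$ be the set of continuous $v:(0,T]\to E$ such that $t^{1-\mu}v(t)$ is bounded on $(0,T]$ and tends to $0$ in $E$ as $t\to0+$; let $BC^1_{1-\mu}([0,T],E)$ be the set of $v\in C^1((0,T],E)$ with $v,\dot v\in BC_{1-\mu}([0,T],E)$; and put $\mathbb E_{1,\mu}([0,T])=BC^1_{1-\mu}([0,T],E_0)\cap BC_{1-\mu}([0,T],E_1)$. For $u\in\mathbb E_{1,\mu}([0,T])$ the limit $u(0):=\lim_{t\to0+}u(t)$ exists in $E_0$. Let $\mathcal M_\mu(E_1,E_0)$ be the set of bounded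 linear operators $B:E_1\to E_0$ such that, for some $T>0$, for every $f\in BC_{1-\mu}([0,T],E_0)$ and $x\in E_\mu$ there is a unique $u\in\mathbb E_{1,\mu}([0,T])$ with $\dot u+Bu=f$ on $(0,T]$ and $u(0)=x$. Let $V_\mu\subset E_\mu$ be open, and assume: (H1) $(A,F_1):V_\mu\to\mathcal M_\mu(E_1,E_0)\times E_0$ is locally Lipschitz continuous, where $V_\mu$ carries the topology of $E_\mu$ and $\mathcal M_\mu(E_1,E_0)$ the operator norm of $\mathcal L(E_1,E_0)$. (H2) There is $\beta\in(\mu,1)$ with $F_2:V_\mu\cap E_\beta\to E_0$, and there are $m\in\mathbb N$ and numbers $\beta_j\in[\mu,\beta]$, $\rho_j\ge0$ with $$\frac{\rho_j(\beta-\mu)+(\beta_j-\mu)}{1-\mu}\le1\qquad(j=1,\dots,m)$$ such that for each $x_0\in V_\mu$ and $R>0$ there is a constant $C_R=C_R(x_0)>0$ with $$|F_2(x_1)-F_2(x_2)|_{E_0}\le C_R\sum_{j=1}^m\bigl(1+|x_1|_{E_\beta}^{\rho_j}+|x_2|_{E_\beta}^{\rho_j}\bigr)|x_1-x_2|_{E_{\beta_j}}$$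 for all $x_1,x_2\in V_\mu\cap E_\beta$ with $|x_k-x_0|_{E_\mu}\le R$, $k=1,2$. Consider the problem $$\dot u+A(u)u=F_1(u)+F_2(u)\quad(t>0),\qquad u(0)=x. \tag{1}$$ A solution of (1) on $[0,T]$ is a function $u\in\mathbb E_{1,\mu}([0,T])$ with $u(t)\in V_\mu$ for all $t\in[0,T]$ that satisfies the equation on $(0,T]$ and $u(0)=x$; a global solution is a function on $[0,\infty)$ whose restriction to $[0,T]$ is a solution for every $T>0$. An equilibrium is an element $u_*\in V_\mu\cap E_1$ with $A(u_*)u_*=F_1(u_*)+F_2(u_*)$. For $\nu\in(0,1)$ with $\nu\ge\mu$, the equilibrium $u_*$ is called stable in the topology of $E_\nu$ if for every $\varepsilon>0$ there is $\delta>0$ such that for every $x\in E_\nu$ with $|x-u_*|_{E_\nu}<\delta$, problem (1) has a global solution and every solution $u$ of (1), on any interval $[0,T]$, satisfies $|u(t)-u_*|_{E_\nu}<\varepsilon$ for all $t\in[0,T]$. **Proposition.** Let $\bar\mu\in[\beta,1)$ and let $u_*\in V_\mu\cap E_1$ be an equilibrium. Then $u_*$ is stable in the topology of $E_\mu$ if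 and only if $u_*$ is stable in the topology of $E_{\bar\mu}$. -/

import Mathlib

open Set Filter Topology

namespace QuasiPar

variable {E : Type*} [NormedAddCommGroup E] [NormedSpace ℝ E]
variable {E₀ E₁ : Type*} [NormedAddCommGroup E₀] [NormedSpace ℝ E₀]
  [NormedAddCommGroup E₁] [NormedSpace ℝ E₁]

/-! ### Continuous interpolation spaces

The embedding `E₁ ↪ E₀` is an injective bounded linear map `i` with dense range; all spaces between
`E₁` and `E₀` are regarded as subsets of `E₀`. -/

/-- Peetre's functional `K(t, x) = inf {|x - y|_{E₀} + t |y|_{E₁} : y ∈ E₁}`. -/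
noncomputable def kFunctional (i : E₁ →L[ℝ] E₀) (t : ℝ) (x : E₀) : ℝ :=
  ⨅ y : E₁, (‖x - i y‖ + t * ‖y‖)

/-- The continuous interpolation space `E_θ = (E₀, E₁)⁰_{θ,∞}`, `0 < θ < 1`, as a subset of `E₀`:
the `x` with `t ^ (-θ) K(t, x) → 0` as `t → 0+`.  (As `E₁ ⊆ E₀`, one has `K(t, x) ≤ |x|_{E₀}`, so
`t ^ (-θ) K(t, x)` is then bounded on `(0, ∞)` and also tends to `0` at infinity; this set is the
closure of `E₁` in the real interpolation space `(E₀, E₁)_{θ,∞}`.) -/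
def interpSpace (i : E₁ →L[ℝ] E₀) (θ : ℝ) : Set E₀ :=
  {x | Tendsto (fun t : ℝ => t ^ (-θ) * kFunctional i t x) (𝓝[>] 0) (𝓝 0)}

/-- The norm `|x|_{E_θ} = sup {t ^ (-θ) K(t, x) : t > 0}`; the supremum is finite on `E_θ`, and it
is used only there. -/
noncomputable def interpNorm (i : E₁ →L[ℝ] E₀) (θ : ℝ) (x : E₀) : ℝ :=
  ⨆ t : Ioi (0 : ℝ), (t : ℝ) ^ (-θ) * kFunctional i t x

/-- `V` is an open subset of the normed space `E_θ`. -/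
def IsOpenInInterp (i : E₁ →L[ℝ] E₀) (θ : ℝ) (V : Set E₀) : Prop :=
  V ⊆ interpSpace i θ ∧
    ∀ x ∈ V, ∃ r > 0, ∀ y ∈ interpSpace i θ, interpNorm i θ (y - x) < r → y ∈ V

/-! ### Time-weighted spaces on `J = [0, T]` -/

/-- `f ∈ BC_{1-μ}([0, T], E)`; only the values of `f` on `(0, T]` matter. -/
structure IsBC (μ T : ℝ) (f : ℝ → E) : Prop where
  continuousOn : ContinuousOn f (Ioc 0 T)
  bounded : ∃ C : ℝ, ∀ t ∈ Ioc 0 T, ‖t ^ (1 - μ) • f t‖ ≤ C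
  vanishing : Tendsto (fun t : ℝ => ‖t ^ (1 - μ) • f t‖) (𝓝[>] 0) (𝓝 0)

/-- `u ∈ 𝔼_{1,μ}([0, T]) = BC¹_{1-μ}([0, T], E₀) ∩ BC_{1-μ}([0, T], E₁)`, where `v` is `u` regarded
as a function with values in `E₁`, and `u'` is the time derivative of `u` on `(0, T]` (one-sided
at `T`).  At `t = 0` the function `u` takes its trace, i.e. it is continuous there in `E₀`. -/
structure IsMaxRegFun (i : E₁ →L[ℝ] E₀) (μ T : ℝ)
    (u : ℝ → E₀) (v : ℝ → E₁) (u' : ℝ → E₀) : Prop where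
  lift : ∀ t ∈ Ioc 0 T, i (v t) = u t
  hasDeriv : ∀ t ∈ Ioc 0 T, HasDerivWithinAt u (u' t) (Ioc 0 T) t
  bc : IsBC μ T u
  bc_deriv : IsBC μ T u'
  bc_lift : IsBC μ T v
  trace : Tendsto u (𝓝[>] 0) (𝓝 (u 0))

/-- `u ∈ 𝔼_{1,μ}([0, T])` solves `u' + B u = f` on `(0, T]`, `u(0) = x`. -/
def IsLinearSolution (i : E₁ →L[ℝ] E₀) (μ T : ℝ) (B : E₁ →L[ℝ] E₀) (f : ℝ → E₀) (x : E₀)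
    (u : ℝ → E₀) : Prop :=
  ∃ (v : ℝ → E₁) (u' : ℝ → E₀), IsMaxRegFun i μ T u v u' ∧ u 0 = x ∧
    ∀ t ∈ Ioc 0 T, u' t + B (v t) = f t

/-- The class `𝓜_μ(E₁, E₀)` of operators with continuous maximal regularity: for some `T > 0`, the
linear problem has, for all `f ∈ 𝔼_{0,μ}([0, T]) = BC_{1-μ}([0, T], E₀)` and all `x ∈ E_μ`, exactly
one solution in `𝔼_{1,μ}([0, T])`. -/
def maxRegClass (i : E₁ →L[ℝ] E₀) (μ : ℝ) : Set (E₁ →L[ℝ] E₀) :=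
  {B | ∃ T > 0, ∀ f : ℝ → E₀, IsBC μ T f → ∀ x ∈ interpSpace i μ,
    (∃ u : ℝ → E₀, IsLinearSolution i μ T B f x u) ∧
    ∀ u w : ℝ → E₀, IsLinearSolution i μ T B f x u → IsLinearSolution i μ T B f x w →
      EqOn u w (Icc 0 T)}

/-! ### Hypotheses on the quasilinear problem

`A` and `F₁` are functions on `V ⊆ E_μ`, and `F₂` is a function on `V ∩ E_β`; their values elsewhere
in `E₀` are never used. -/

/-- Hypothesis (H1): `(A, F₁) : V → 𝓜_μ(E₁, E₀) × E₀` is locally Lipschitz continuous for the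
norm of `E_μ` on `V` and the operator norm of `L(E₁, E₀)`. -/
structure HypH1 (i : E₁ →L[ℝ] E₀) (μ : ℝ) (V : Set E₀) (A : E₀ → E₁ →L[ℝ] E₀)
    (F₁ : E₀ → E₀) : Prop where
  maxReg : ∀ x ∈ V, A x ∈ maxRegClass i μ
  lipschitz : ∀ x₀ ∈ V, ∃ r > 0, ∃ L : ℝ, ∀ x₁ ∈ V, ∀ x₂ ∈ V,
    interpNorm i μ (x₁ - x₀) < r → interpNorm i μ (x₂ - x₀) < r →
      ‖A x₁ - A x₂‖ ≤ L * interpNorm i μ (x₁ - x₂) ∧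
      ‖F₁ x₁ - F₁ x₂‖ ≤ L * interpNorm i μ (x₁ - x₂)

/-- Hypothesis (H2), with the number `β` made explicit: structural regularity of `F₂` with possibly
critical exponents. -/
def HypH2 (i : E₁ →L[ℝ] E₀) (μ : ℝ) (V : Set E₀) (F₂ : E₀ → E₀) (β : ℝ) : Prop :=
  β ∈ Ioo μ 1 ∧
  ∃ (m : ℕ) (b ρ : Fin m → ℝ),
    (∀ j, b j ∈ Icc μ β ∧ 0 ≤ ρ j ∧ (ρ j * (β - μ) + (b j - μ)) / (1 - μ) ≤ 1) ∧
    ∀ x₀ ∈ V, ∀ R > 0, ∃ C > 0,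
      ∀ x₁ ∈ V ∩ interpSpace i β, ∀ x₂ ∈ V ∩ interpSpace i β,
        interpNorm i μ (x₁ - x₀) ≤ R → interpNorm i μ (x₂ - x₀) ≤ R →
        ‖F₂ x₁ - F₂ x₂‖ ≤ C * ∑ j : Fin m,
          (1 + interpNorm i β x₁ ^ ρ j + interpNorm i β x₂ ^ ρ j) * interpNorm i (b j) (x₁ - x₂)

/-! ### Solutions, equilibria, stability -/

/-- `u ∈ 𝔼_{1,μ}([0, T])` takes values in `V` and solves `u' + A(u) u = F₁(u) + F₂(u)` on `(0, T]`,
`u(0) = x`. -/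
def IsSolution (i : E₁ →L[ℝ] E₀) (μ : ℝ) (V : Set E₀) (A : E₀ → E₁ →L[ℝ] E₀) (F₁ F₂ : E₀ → E₀)
    (T : ℝ) (x : E₀) (u : ℝ → E₀) : Prop :=
  ∃ (v : ℝ → E₁) (u' : ℝ → E₀), IsMaxRegFun i μ T u v u' ∧ u 0 = x ∧
    (∀ t ∈ Icc 0 T, u t ∈ V) ∧
    ∀ t ∈ Ioc 0 T, u' t + A (u t) (v t) = F₁ (u t) + F₂ (u t)

/-- `u` is a global solution with initial value `x`. -/
def IsGlobalSolution (i : E₁ →L[ℝ] E₀) (μ : ℝ) (V : Set E₀) (A : E₀ → E₁ →L[ℝ] E₀)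
    (F₁ F₂ : E₀ → E₀) (x : E₀) (u : ℝ → E₀) : Prop :=
  ∀ T > 0, IsSolution i μ V A F₁ F₂ T x u

/-- `y ∈ V ∩ E₁` is an equilibrium: `A(y) y = F₁(y) + F₂(y)`. -/
def IsEquilibrium (i : E₁ →L[ℝ] E₀) (V : Set E₀) (A : E₀ → E₁ →L[ℝ] E₀) (F₁ F₂ : E₀ → E₀)
    (y : E₁) : Prop :=
  i y ∈ V ∧ A (i y) y = F₁ (i y) + F₂ (i y)

/-- `y` is stable in the topology of `E_ν`: for each `ε > 0` there is `δ > 0` such that for every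
initial value `x` in the ball `B_{E_ν}(y, δ)` the problem has a global solution, and every solution
with this initial value stays in `B_{E_ν}(y, ε)`.  The notion of solution does not depend on `ν`. -/
def IsStableIn (i : E₁ →L[ℝ] E₀) (μ : ℝ) (V : Set E₀) (A : E₀ → E₁ →L[ℝ] E₀) (F₁ F₂ : E₀ → E₀)
    (ν : ℝ) (y : E₀) : Prop :=
  ∀ ε > 0, ∃ δ > 0, ∀ x ∈ interpSpace i ν, interpNorm i ν (x - y) < δ →
    (∃ u : ℝ → E₀, IsGlobalSolution i μ V A F₁ F₂ x u) ∧
    ∀ T > 0, ∀ u : ℝ → E₀, IsSolution i μ V A F₁ F₂ T x u →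
      ∀ t ∈ Icc 0 T, u t ∈ interpSpace i ν ∧ interpNorm i ν (u t - y) < ε

end QuasiPar

/-!
Writing `u = u_* + w`, the problem near the equilibrium becomes `w' + A(u_*) w = N(w)`, where the
remainder `N` vanishes at `0`. Maximal regularity of `A(u_*)` bounds `w` by its initial value and by
`N(w)` in the weighted norm `max (t ^ (1 - θ) * ‖w‖_{E₁}) ‖w‖_{E_θ}`, for `θ = μ` and for any
`θ = ν ≥ β`, with one constant for all intervals `(0, τ]` with `τ` bounded. The criticality
condition on the exponents makes `N` Lipschitz in the norm for `θ = μ`, with a constant that tends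
to `0` with the interval and the size of `w`. Hence there is a fixed interval `(0, ε]` on which
every initial value close to `u_*` in `E_μ` has a unique solution; it stays close to `u_*` in `E_μ`,
also in `E_ν` if it starts close there, and at each fixed time `a > 0` it is close to `u_*` in `E_ν`
in any case. Stability in `E_μ` therefore gives stability in `E_ν` by restarting at time `t - ε`,
and conversely by restarting at a fixed time `a < ε`.
-/

namespace QuasiPar

/-! ### Continuous interpolation spaces -/

section Interpolation

variable {E₀ E₁ : Type*} [NormedAddCommGroup E₀] [NormedSpace ℝ E₀]
  [NormedAddCommGroup E₁] [NormedSpace ℝ E₁] {i : E₁ →L[ℝ] E₀} {t θ θ' : ℝ} {x x' : E₀}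

lemma kFunctional_le (ht : 0 ≤ t) (x : E₀) (y : E₁) :
    kFunctional i t x ≤ ‖x - i y‖ + t * ‖y‖ :=
  ciInf_le ⟨0, by rintro _ ⟨y, rfl⟩; positivity⟩ y

lemma kFunctional_nonneg (ht : 0 ≤ t) (x : E₀) : 0 ≤ kFunctional i t x :=
  le_ciInf fun y => by positivity

lemma le_mul_kFunctional {c C : ℝ} (hC : 0 ≤ C)
    (h : ∀ y : E₁, c ≤ C * (‖x - i y‖ + t * ‖y‖)) : c ≤ C * kFunctional i t x := by
  rw [kFunctional, Real.mul_iInf_of_nonneg hC]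
  exact le_ciInf h

lemma kFunctional_le_norm (ht : 0 ≤ t) (x : E₀) : kFunctional i t x ≤ ‖x‖ := by
  simpa using kFunctional_le (i := i) ht x 0

lemma kFunctional_apply_le (ht : 0 ≤ t) (y : E₁) : kFunctional i t (i y) ≤ t * ‖y‖ := by
  simpa using kFunctional_le (i := i) ht (i y) y

lemma kFunctional_add_le (ht : 0 ≤ t) (x x' : E₀) :
    kFunctional i t (x + x') ≤ kFunctional i t x + kFunctional i t x' := by
  refine le_ciInf_add_ciInf fun y y' => (kFunctional_le ht _ (y + y')).trans ?_
  have hE₀ : ‖x + x' - i (y + y')‖ ≤ ‖x - i y‖ + ‖x' - i y'‖ := by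
    rw [map_add, add_sub_add_comm]
    exact norm_add_le _ _
  have hE₁ : t * ‖y + y'‖ ≤ t * (‖y‖ + ‖y'‖) := by gcongr; exact norm_add_le _ _
  linarith

lemma kFunctional_neg (x : E₀) : kFunctional i t (-x) = kFunctional i t x := by
  unfold kFunctional
  rw [← (Equiv.neg E₁).iInf_comp]
  refine iInf_congr fun y => ?_
  rw [Equiv.neg_apply, map_neg, norm_neg, ← neg_sub', norm_neg]

lemma norm_le_mul_kFunctional_one (x : E₀) : ‖x‖ ≤ max 1 ‖i‖ * kFunctional i 1 x :=
  le_mul_kFunctional (by positivity) fun y => by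
    calc ‖x‖ ≤ ‖x - i y‖ + ‖i y‖ := by simpa using norm_add_le (x - i y) (i y)
      _ ≤ max 1 ‖i‖ * ‖x - i y‖ + max 1 ‖i‖ * ‖y‖ := by
        gcongr
        · exact le_mul_of_one_le_left (norm_nonneg _) (le_max_left _ _)
        · exact i.le_of_opNorm_le (le_max_right _ _) y
      _ = max 1 ‖i‖ * (‖x - i y‖ + 1 * ‖y‖) := by ring

lemma mem_interpSpace_of_le {g : ℝ → ℝ} (hg : Tendsto g (𝓝[>] 0) (𝓝 0))
    (h : ∀ᶠ t in 𝓝[>] 0, t ^ (-θ) * kFunctional i t x ≤ g t) : x ∈ interpSpace i θ := by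
  refine squeeze_zero' ?_ h hg
  filter_upwards [self_mem_nhdsWithin] with t (ht : 0 < t)
  exact mul_nonneg (by positivity) (kFunctional_nonneg ht.le _)

lemma apply_mem_interpSpace (hθ : θ < 1) (y : E₁) : i y ∈ interpSpace i θ := by
  have hlim : Tendsto (fun t : ℝ => t ^ (1 - θ) * ‖y‖) (𝓝[>] 0) (𝓝 0) := by
    have h := (Real.continuous_rpow_const (sub_pos.2 hθ).le).continuousAt (x := 0)
    simpa [Real.zero_rpow (sub_pos.2 hθ).ne'] using
      (h.tendsto.mono_left nhdsWithin_le_nhds).mul_const ‖y‖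
  refine mem_interpSpace_of_le hlim ?_
  filter_upwards [self_mem_nhdsWithin] with t (ht : 0 < t)
  calc t ^ (-θ) * kFunctional i t (i y) ≤ t ^ (-θ) * (t * ‖y‖) := by
        gcongr
        exact kFunctional_apply_le ht.le y
    _ = t ^ (1 - θ) * ‖y‖ := by
        rw [← mul_assoc, ← Real.rpow_add_one ht.ne', neg_add_eq_sub]

lemma zero_mem_interpSpace (hθ : θ < 1) : (0 : E₀) ∈ interpSpace i θ := by
  simpa using apply_mem_interpSpace (i := i) hθ 0

lemma add_mem_interpSpace (hx : x ∈ interpSpace i θ) (hx' : x' ∈ interpSpace i θ) :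
    x + x' ∈ interpSpace i θ := by
  have hlim : Tendsto _ _ _ := Tendsto.add hx hx'
  rw [add_zero] at hlim
  refine mem_interpSpace_of_le hlim ?_
  filter_upwards [self_mem_nhdsWithin] with t (ht : 0 < t)
  rw [← mul_add]
  gcongr
  exact kFunctional_add_le ht.le _ _

lemma sub_mem_interpSpace (hx : x ∈ interpSpace i θ) (hx' : x' ∈ interpSpace i θ) :
    x - x' ∈ interpSpace i θ := by
  rw [sub_eq_add_neg]
  refine add_mem_interpSpace hx ?_
  simpa only [interpSpace, mem_ofPred_eq, kFunctional_neg] using hx'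

lemma interpSpace_anti (h : θ ≤ θ') : interpSpace i θ' ⊆ interpSpace i θ := by
  intro x hx
  refine mem_interpSpace_of_le hx ?_
  filter_upwards [Ioo_mem_nhdsGT one_pos] with t ht
  exact mul_le_mul_of_nonneg_right
    (Real.rpow_le_rpow_of_exponent_ge ht.1 ht.2.le (neg_le_neg h)) (kFunctional_nonneg ht.1.le _)

lemma interpNorm_nonneg (x : E₀) : 0 ≤ interpNorm i θ x :=
  Real.iSup_nonneg fun t => mul_nonneg (Real.rpow_nonneg (le_of_lt t.2) _)
    (kFunctional_nonneg (le_of_lt t.2) _)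

lemma interpNorm_le {M : ℝ} (h : ∀ t > 0, kFunctional i t x ≤ t ^ θ * M) :
    interpNorm i θ x ≤ M := by
  have : Nonempty (Ioi (0 : ℝ)) := ⟨⟨1, mem_Ioi.2 one_pos⟩⟩
  refine ciSup_le fun ⟨t, (ht : 0 < t)⟩ => ?_
  rw [Real.rpow_neg ht.le, inv_mul_le_iff₀ (by positivity)]
  exact h t ht

lemma bddAbove_rpow_neg_mul_kFunctional (hθ : 0 ≤ θ) (hx : x ∈ interpSpace i θ) :
    BddAbove (range fun t : Ioi (0 : ℝ) => (t : ℝ) ^ (-θ) * kFunctional i t x) := by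
  obtain ⟨d, hd, hsmall⟩ := mem_nhdsGT_iff_exists_Ioc_subset.1
    ((show Tendsto _ _ _ from hx).eventually_lt_const one_pos)
  refine ⟨max 1 (d ^ (-θ) * ‖x‖), ?_⟩
  rintro _ ⟨⟨t, (ht : 0 < t)⟩, rfl⟩
  rcases le_total t d with h | h
  · exact le_max_of_le_left (hsmall ⟨ht, h⟩).le
  · exact le_max_of_le_right <| mul_le_mul
      (Real.rpow_le_rpow_of_nonpos hd h (neg_nonpos.2 hθ)) (kFunctional_le_norm ht.le x)
      (kFunctional_nonneg ht.le x) (Real.rpow_nonneg (le_of_lt hd) _)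

lemma kFunctional_le_interpNorm (hθ : 0 ≤ θ) (hx : x ∈ interpSpace i θ) (ht : 0 < t) :
    kFunctional i t x ≤ t ^ θ * interpNorm i θ x := by
  have h := le_ciSup (bddAbove_rpow_neg_mul_kFunctional hθ hx) ⟨t, ht⟩
  rwa [Real.rpow_neg ht.le, inv_mul_le_iff₀ (by positivity)] at h

lemma interpNorm_add_le (hθ : 0 ≤ θ) (hx : x ∈ interpSpace i θ) (hx' : x' ∈ interpSpace i θ) :
    interpNorm i θ (x + x') ≤ interpNorm i θ x + interpNorm i θ x' :=
  interpNorm_le fun t ht => by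
    rw [mul_add]
    exact (kFunctional_add_le ht.le _ _).trans (add_le_add (kFunctional_le_interpNorm hθ hx ht)
      (kFunctional_le_interpNorm hθ hx' ht))

lemma interpNorm_zero : interpNorm i θ (0 : E₀) = 0 :=
  le_antisymm (interpNorm_le fun t ht => by
    simpa using kFunctional_le_norm (i := i) ht.le (0 : E₀)) (interpNorm_nonneg _)

lemma interpNorm_apply_le (hθ : θ ∈ Icc (0 : ℝ) 1) (y : E₁) :
    interpNorm i θ (i y) ≤ max 1 ‖i‖ * ‖y‖ :=
  interpNorm_le fun t ht => by
    rcases le_total t 1 with h | h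
    · have ht1 : t ≤ t ^ θ := by
        simpa using Real.rpow_le_rpow_of_exponent_ge ht h hθ.2
      refine (kFunctional_apply_le ht.le y).trans
        (mul_le_mul ht1 ?_ (norm_nonneg _) (by positivity))
      exact le_mul_of_one_le_left (norm_nonneg _) (le_max_left _ _)
    · calc kFunctional i t (i y) ≤ ‖i y‖ := kFunctional_le_norm ht.le _
        _ ≤ max 1 ‖i‖ * ‖y‖ := i.le_of_opNorm_le (le_max_right _ _) y
        _ ≤ t ^ θ * (max 1 ‖i‖ * ‖y‖) :=
          le_mul_of_one_le_left (by positivity) (Real.one_le_rpow h hθ.1)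

lemma interpNorm_le_mul_interpNorm (hθ : 0 ≤ θ) (h : θ ≤ θ') (hx : x ∈ interpSpace i θ') :
    interpNorm i θ x ≤ max 1 ‖i‖ * interpNorm i θ' x :=
  interpNorm_le fun t ht => by
    have h0 : 0 ≤ interpNorm i θ' x := interpNorm_nonneg _
    rcases le_total t 1 with h1 | h1
    · refine (kFunctional_le_interpNorm (hθ.trans h) hx ht).trans ?_
      exact mul_le_mul (Real.rpow_le_rpow_of_exponent_ge ht h1 h)
        (le_mul_of_one_le_left h0 (le_max_left _ _)) h0 (by positivity)
    · have hK : kFunctional i 1 x ≤ interpNorm i θ' x := by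
        simpa using kFunctional_le_interpNorm (hθ.trans h) hx one_pos
      calc kFunctional i t x ≤ ‖x‖ := kFunctional_le_norm ht.le _
        _ ≤ max 1 ‖i‖ * kFunctional i 1 x := norm_le_mul_kFunctional_one x
        _ ≤ max 1 ‖i‖ * interpNorm i θ' x := by gcongr
        _ ≤ t ^ θ * (max 1 ‖i‖ * interpNorm i θ' x) :=
          le_mul_of_one_le_left (by positivity) (Real.one_le_rpow h1 hθ)

/-- The usual interpolation inequality with the free parameter `a` still to be optimized; a power
of the time variable is the right choice of `a` in all applications. -/
lemma interpNorm_apply_le_max (hθ : 0 ≤ θ) (h : θ ≤ θ') (hθ' : θ' < 1) {a : ℝ} (ha : 0 < a)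
    (w : E₁) : interpNorm i θ' (i w) ≤
      max (a ^ (θ - θ') * interpNorm i θ (i w)) (a ^ (1 - θ') * ‖w‖) :=
  interpNorm_le fun t ht => by
    rcases le_total a t with hat | hat
    · calc kFunctional i t (i w) ≤ t ^ θ * interpNorm i θ (i w) :=
            kFunctional_le_interpNorm hθ (apply_mem_interpSpace (h.trans_lt hθ') w) ht
        _ = t ^ θ' * (t ^ (θ - θ') * interpNorm i θ (i w)) := by
          rw [← mul_assoc, ← Real.rpow_add ht, add_sub_cancel]
        _ ≤ t ^ θ' * (a ^ (θ - θ') * interpNorm i θ (i w)) := by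
          have := interpNorm_nonneg (i := i) (θ := θ) (i w)
          have := Real.rpow_le_rpow_of_nonpos ha hat (sub_nonpos.2 h)
          gcongr
        _ ≤ _ := by gcongr; exact le_max_left _ _
    · calc kFunctional i t (i w) ≤ t * ‖w‖ := kFunctional_apply_le ht.le w
        _ = t ^ θ' * (t ^ (1 - θ') * ‖w‖) := by
          rw [← mul_assoc, ← Real.rpow_add ht, add_sub_cancel, Real.rpow_one]
        _ ≤ t ^ θ' * (a ^ (1 - θ') * ‖w‖) := by
          have := Real.rpow_le_rpow ht.le hat (sub_pos.2 hθ').le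
          gcongr
        _ ≤ _ := by gcongr; exact le_max_right _ _

end Interpolation

/-! ### Time-weighted spaces -/

section WeightedBound

variable {E : Type*} [NormedAddCommGroup E] {μ t T T' M : ℝ} {f g : ℝ → E}

lemma rpow_sub_one_mul_rpow_one_sub (ht : 0 < t) (μ : ℝ) : t ^ (μ - 1) * t ^ (1 - μ) = 1 := by
  rw [← Real.rpow_add ht, sub_add_sub_cancel, sub_self, Real.rpow_zero]

/-- The bound `|f| ≤ M` for the norm `sup {t ^ (1 - μ) |f(t)| : 0 < t ≤ T}` of
`BC_{1-μ}([0, T], E)`. -/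
def WeightedBound (μ T : ℝ) (f : ℝ → E) (M : ℝ) : Prop :=
  ∀ t ∈ Ioc 0 T, t ^ (1 - μ) * ‖f t‖ ≤ M

namespace WeightedBound

lemma nonneg (hT : 0 < T) (h : WeightedBound μ T f M) : 0 ≤ M :=
  (by positivity : 0 ≤ T ^ (1 - μ) * ‖f T‖).trans (h T ⟨hT, le_rfl⟩)

lemma mono (h : WeightedBound μ T f M) (hT : T' ≤ T) : WeightedBound μ T' f M :=
  fun t ht => h t ⟨ht.1, ht.2.trans hT⟩

lemma congr (h : WeightedBound μ T f M) (hg : EqOn g f (Ioc 0 T)) : WeightedBound μ T g M :=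
  fun t ht => by rw [hg ht]; exact h t ht

lemma norm_le (h : WeightedBound μ T f M) (ht : t ∈ Ioc 0 T) : ‖f t‖ ≤ t ^ (μ - 1) * M := by
  have ht0 : 0 < t := ht.1
  calc ‖f t‖ = t ^ (μ - 1) * (t ^ (1 - μ) * ‖f t‖) := by
        rw [← mul_assoc, rpow_sub_one_mul_rpow_one_sub ht0, one_mul]
    _ ≤ t ^ (μ - 1) * M := by gcongr; exact h t ht

lemma mul_norm_le (h : WeightedBound μ T f M) (ht : t ∈ Ioc 0 T) : t * ‖f t‖ ≤ t ^ μ * M := by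
  have ht0 : 0 < t := ht.1
  calc t * ‖f t‖ = t ^ μ * (t ^ (1 - μ) * ‖f t‖) := by
        rw [← mul_assoc, ← Real.rpow_add ht0, add_sub_cancel, Real.rpow_one]
    _ ≤ t ^ μ * M := by gcongr; exact h t ht

lemma const_of_le (hμ : μ ≤ 1) (h : WeightedBound μ T f M) (ht : t ∈ Ioc 0 T) :
    WeightedBound μ t (fun _ => f t) M := fun _ hs =>
  (mul_le_mul_of_nonneg_right (Real.rpow_le_rpow hs.1.le hs.2 (sub_nonneg.2 hμ))
    (norm_nonneg _)).trans (h t ht)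

lemma intervalIntegrable (hμ : 0 < μ) (h : WeightedBound μ T f M)
    (hf : ContinuousOn f (Ioc 0 T)) (ht : t ∈ Icc 0 T) :
    IntervalIntegrable f MeasureTheory.volume 0 t := by
  have hdom : IntervalIntegrable (fun s : ℝ => s ^ (μ - 1) * M) MeasureTheory.volume 0 t :=
    (intervalIntegral.intervalIntegrable_rpow' (by linarith)).mul_const M
  refine hdom.mono_fun' ?_ ?_
  all_goals rw [uIoc_of_le ht.1]
  · exact (hf.mono (Ioc_subset_Ioc_right ht.2)).aestronglyMeasurable measurableSet_Ioc
  · filter_upwards [MeasureTheory.ae_restrict_mem measurableSet_Ioc] with s hs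
    exact h.norm_le ⟨hs.1, hs.2.trans ht.2⟩

end WeightedBound

end WeightedBound

section Weight

variable {E F : Type*} [NormedAddCommGroup E] [NormedSpace ℝ E]
  [NormedAddCommGroup F] [NormedSpace ℝ F] {μ t T T' : ℝ} {f g : ℝ → E}

lemma norm_rpow_smul (ht : 0 ≤ t) (a : ℝ) (e : E) : ‖t ^ a • e‖ = t ^ a * ‖e‖ := by
  rw [norm_smul, Real.norm_of_nonneg (Real.rpow_nonneg ht a)]

lemma continuousOn_Icc_iff {X : Type*} [TopologicalSpace X] {a b : ℝ} {φ : ℝ → X} (hab : a < b) :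
    ContinuousOn φ (Icc a b) ↔ ContinuousOn φ (Ioc a b) ∧ Tendsto φ (𝓝[>] a) (𝓝 (φ a)) := by
  have h := continuousOn_update_iff (f := φ) (s := Icc a b) (x := a) (y := φ a)
  rwa [Function.update_eq_self, Icc_sdiff_left, nhdsWithin_Ioc_eq_nhdsGT hab,
    forall_prop_of_true (left_mem_Icc.2 hab.le)] at h

lemma tendsto_nhdsGT_of_continuousOn_Icc {X : Type*} [TopologicalSpace X] {a b : ℝ} {φ : ℝ → X}
    (hab : a < b) (h : ContinuousOn φ (Icc a b)) : Tendsto φ (𝓝[>] a) (𝓝 (φ a)) :=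
  ((continuousOn_Icc_iff hab).1 h).2

lemma continuousOn_rpow_Ioi (a : ℝ) : ContinuousOn (fun t : ℝ => t ^ a) (Ioi 0) :=
  fun _ ht => (Real.continuousAt_rpow_const _ _ (.inl (ne_of_gt ht))).continuousWithinAt

namespace WeightedBound

variable {M : ℝ}

lemma norm_integral_le (hμ : 0 < μ) (hT : 0 ≤ T) (h : WeightedBound μ T f M) :
    ‖∫ s in (0 : ℝ)..T, f s‖ ≤ T ^ μ * M / μ := by
  have hint : IntervalIntegrable (fun s : ℝ => s ^ (μ - 1) * M) MeasureTheory.volume 0 T :=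
    (intervalIntegral.intervalIntegrable_rpow' (by linarith)).mul_const M
  refine (intervalIntegral.norm_integral_le_of_norm_le hT
    (.of_forall fun s hs => h.norm_le hs) hint).trans_eq ?_
  rw [intervalIntegral.integral_mul_const, integral_rpow (.inl (by linarith)), sub_add_cancel,
    Real.zero_rpow hμ.ne']
  ring

end WeightedBound

lemma isBC_iff (hμ : μ < 1) (hT : 0 < T) :
    IsBC μ T f ↔ ContinuousOn (fun t : ℝ => t ^ (1 - μ) • f t) (Icc 0 T) := by
  have h0 : (0 : ℝ) ^ (1 - μ) • f 0 = 0 := by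
    rw [Real.zero_rpow (sub_pos.2 hμ).ne', zero_smul]
  have hrpow (a : ℝ) : ContinuousOn (fun t : ℝ => t ^ a) (Ioc 0 T) :=
    (continuousOn_rpow_Ioi a).mono Ioc_subset_Ioi_self
  constructor
  · intro h
    refine (continuousOn_Icc_iff hT).2 ⟨(hrpow _).smul h.continuousOn, ?_⟩
    exact h0.symm ▸ tendsto_zero_iff_norm_tendsto_zero.2 h.vanishing
  · intro h
    obtain ⟨hIoc, hlim⟩ := (continuousOn_Icc_iff hT).1 h
    refine ⟨((hrpow (μ - 1)).smul hIoc).congr fun t ht => ?_, ?_, ?_⟩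
    · rw [Pi.smul_apply', smul_smul, rpow_sub_one_mul_rpow_one_sub ht.1, one_smul]
    · exact (isCompact_Icc.exists_bound_of_continuousOn h).imp fun C hC t ht =>
        hC t (Ioc_subset_Icc_self ht)
    · exact tendsto_zero_iff_norm_tendsto_zero.1 (h0 ▸ hlim)

lemma isBC_of_continuousOn (hμ : μ < 1) (hT : 0 < T) (hf : ContinuousOn f (Icc 0 T)) :
    IsBC μ T f :=
  (isBC_iff hμ hT).2 <| (Real.continuous_rpow_const (sub_pos.2 hμ).le).continuousOn.smul hf

lemma isBC_const (hμ : μ < 1) (hT : 0 < T) (c : E) : IsBC μ T (fun _ => c) :=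
  isBC_of_continuousOn hμ hT continuousOn_const

namespace IsBC

lemma exists_weightedBound (hf : IsBC μ T f) : ∃ M, WeightedBound μ T f M :=
  hf.bounded.imp fun M hM t ht => by
    rw [← norm_rpow_smul ht.1.le]
    exact hM t ht

lemma congr (hT : 0 < T) (hf : IsBC μ T f) (h : EqOn g f (Ioc 0 T)) : IsBC μ T g where
  continuousOn := hf.continuousOn.congr h
  bounded := hf.bounded.imp fun C hC t ht => by rw [h ht]; exact hC t ht
  vanishing := hf.vanishing.congr' <| by
    filter_upwards [Ioc_mem_nhdsGT hT] with t ht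
    rw [h ht]

lemma mono (hf : IsBC μ T f) (h : T' ≤ T) : IsBC μ T' f where
  continuousOn := hf.continuousOn.mono (Ioc_subset_Ioc_right h)
  bounded := hf.bounded.imp fun _ hC t ht => hC t ⟨ht.1, ht.2.trans h⟩
  vanishing := hf.vanishing

lemma add (hμ : μ < 1) (hT : 0 < T) (hf : IsBC μ T f) (hg : IsBC μ T g) :
    IsBC μ T (fun t => f t + g t) := by
  rw [isBC_iff hμ hT] at *
  exact (hf.add hg).congr fun t _ => smul_add _ _ _

lemma clm_comp (hμ : μ < 1) (hT : 0 < T) (hf : IsBC μ T f) (B : E →L[ℝ] F) :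
    IsBC μ T (fun t => B (f t)) := by
  rw [isBC_iff hμ hT] at *
  simpa only [Function.comp_def, map_smul] using B.continuous.comp_continuousOn hf

lemma smul (hμ : μ < 1) (hT : 0 < T) (hf : IsBC μ T f) {φ : ℝ → ℝ}
    (hφ : ContinuousOn φ (Icc 0 T)) : IsBC μ T (fun t => φ t • f t) := by
  rw [isBC_iff hμ hT] at *
  exact (hφ.smul hf).congr fun t _ => smul_comm _ _ _

lemma const_smul (hμ : μ < 1) (hT : 0 < T) (hf : IsBC μ T f) (c : ℝ) :
    IsBC μ T (fun t => c • f t) :=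
  hf.smul hμ hT continuousOn_const

lemma sub (hμ : μ < 1) (hT : 0 < T) (hf : IsBC μ T f) (hg : IsBC μ T g) :
    IsBC μ T (fun t => f t - g t) := by
  simpa [sub_eq_add_neg] using hf.add hμ hT (hg.const_smul hμ hT (-1))

lemma shift (hμ : μ < 1) (hf : IsBC μ T f) {a : ℝ} (ha : 0 < a) (haT : a < T) :
    IsBC μ (T - a) (fun s => f (a + s)) :=
  isBC_of_continuousOn hμ (sub_pos.2 haT) <| hf.continuousOn.comp (by fun_prop)
    fun s hs => ⟨by linarith [hs.1], by linarith [hs.2]⟩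

lemma glue (hμ : μ < 1) {a : ℝ} (ha : 0 < a) (haT : a < T) (hf : IsBC μ a f)
    (hg : ContinuousOn g (Ioc 0 (T - a))) (hfg : Tendsto g (𝓝[>] 0) (𝓝 (f a))) :
    IsBC μ T (fun t => if t ≤ a then f t else g (t - a)) := by
  set h : ℝ → E := fun t => if t ≤ a then f t else g (t - a)
  have hh : EqOn h (fun t => g (t - a)) (Ioi a) := fun t (ht : a < t) => if_neg ht.not_ge
  have hlim : Tendsto h (𝓝[>] a) (𝓝 (h a)) := by
    have hsub : Tendsto (fun t => t - a) (𝓝[>] a) (𝓝[>] 0) :=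
      tendsto_nhdsWithin_iff.2
        ⟨((continuous_sub_right a).tendsto' a 0 (sub_self a)).mono_left nhdsWithin_le_nhds, by
          filter_upwards [self_mem_nhdsWithin] with t ht using mem_Ioi.2 (sub_pos.2 ht)⟩
    rw [show h a = f a from if_pos le_rfl]
    exact (hfg.comp hsub).congr' <| by
      filter_upwards [self_mem_nhdsWithin] with t ht using (hh ht).symm
  have hright : ContinuousOn h (Icc a T) := by
    refine (continuousOn_Icc_iff haT).2 ⟨?_, hlim⟩
    refine (hg.comp (continuous_sub_right a).continuousOn fun t ht => ?_).congr
      (hh.mono Ioc_subset_Ioi_self)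
    exact ⟨sub_pos.2 ht.1, sub_le_sub_right ht.2 a⟩
  rw [isBC_iff hμ ha] at hf
  rw [isBC_iff hμ (ha.trans haT), ← Icc_union_Icc_eq_Icc ha.le haT.le]
  refine ContinuousOn.union_of_isClosed (hf.congr fun t ht => ?_)
    (ContinuousOn.smul ((continuousOn_rpow_Ioi _).mono fun t ht => ha.trans_le ht.1) hright)
    isClosed_Icc isClosed_Icc
  simp only [h, if_pos ht.2]

lemma exists_extend (hμ : μ < 1) {τ : ℝ} (hτ : τ ∈ Ioc 0 T) (hf : IsBC μ τ f) :
    ∃ g, IsBC μ T g ∧ EqOn g f (Ioc 0 τ) ∧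
      ∀ M, WeightedBound μ τ f M → WeightedBound μ T g M := by
  -- The extension is constant beyond `τ` up to the weight, which preserves the weighted norm.
  let g : ℝ → E := fun t => t ^ (μ - 1) • min t τ ^ (1 - μ) • f (min t τ)
  have hg : ∀ t ∈ Ioc 0 T, t ^ (1 - μ) • g t = min t τ ^ (1 - μ) • f (min t τ) := fun t ht => by
    rw [smul_smul, mul_comm, rpow_sub_one_mul_rpow_one_sub ht.1, one_smul]
  refine ⟨g, ?_, fun t ht => ?_, fun M hM t ht => ?_⟩
  · refine (isBC_iff hμ (hτ.1.trans_le hτ.2)).2 <| ((isBC_iff hμ hτ.1).1 hf).comp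
      (f := fun t => min t τ) (by fun_prop)
      (fun t ht => ⟨le_min ht.1 hτ.1.le, min_le_right _ _⟩) |>.congr fun t ht => ?_
    rcases ht.1.eq_or_lt with rfl | ht0
    · simp [hτ.1.le, Real.zero_rpow (sub_pos.2 hμ).ne']
    · exact hg t ⟨ht0, ht.2⟩
  · simp only [g, min_eq_left ht.2, smul_smul, rpow_sub_one_mul_rpow_one_sub ht.1, one_smul]
  · have hmin : min t τ ∈ Ioc 0 τ := ⟨lt_min ht.1 hτ.1, min_le_right _ _⟩
    rw [← norm_rpow_smul ht.1.le, hg t ht, norm_rpow_smul hmin.1.le]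
    exact hM _ hmin

lemma intervalIntegrable (hμ : 0 < μ) (hf : IsBC μ T f) (ht : t ∈ Icc 0 T) :
    IntervalIntegrable f MeasureTheory.volume 0 t := by
  obtain ⟨M, hM⟩ := hf.exists_weightedBound
  exact hM.intervalIntegrable hμ hf.continuousOn ht

lemma continuousOn_integral (hμ : 0 < μ) (hT : 0 ≤ T) (hf : IsBC μ T f) :
    ContinuousOn (fun t => ∫ s in (0 : ℝ)..t, f s) (Icc 0 T) := by
  have h := intervalIntegral.continuousOn_primitive_interval'
    (hf.intervalIntegrable hμ ⟨hT, le_rfl⟩) left_mem_uIcc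
  rwa [uIcc_of_le hT] at h

lemma tendsto_integral (hμ : 0 < μ) (hT : 0 < T) (hf : IsBC μ T f) :
    Tendsto (fun t => ∫ s in (0 : ℝ)..t, f s) (𝓝[>] 0) (𝓝 0) := by
  simpa using tendsto_nhdsGT_of_continuousOn_Icc hT (hf.continuousOn_integral hμ hT.le)

variable [CompleteSpace E]

lemma hasDerivWithinAt_integral (hμ : 0 < μ) (hf : IsBC μ T f) (ht : t ∈ Ioc 0 T) :
    HasDerivWithinAt (fun t => ∫ s in (0 : ℝ)..t, f s) (f t) (Ioc 0 T) t := by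
  have hsub : Icc (t / 2) T ⊆ Ioc 0 T := Icc_subset_Ioc (half_pos ht.1) le_rfl
  have htmem : t ∈ Icc (t / 2) T := ⟨half_le_self ht.1.le, ht.2⟩
  have : Fact (t ∈ Icc (t / 2) T) := ⟨htmem⟩
  have hcont : ContinuousOn f (Icc (t / 2) T) := hf.continuousOn.mono hsub
  have hderiv := intervalIntegral.integral_hasDerivWithinAt_right (s := Icc (t / 2) T)
    (hf.intervalIntegrable hμ ⟨ht.1.le, ht.2⟩)
    (hcont.stronglyMeasurableAtFilter_nhdsWithin measurableSet_Icc t) (hcont t htmem)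
  refine hderiv.mono_of_mem_nhdsWithin ?_
  filter_upwards [self_mem_nhdsWithin,
    mem_nhdsWithin_of_mem_nhds (Ioi_mem_nhds (half_lt_self ht.1))] with s hs hs'
  exact ⟨le_of_lt hs', hs.2⟩

lemma eq_add_integral (hμ : 0 < μ) (hf : IsBC μ T f) {u : ℝ → E} {x : E}
    (hu : ContinuousOn u (Ioc 0 T)) (h0 : Tendsto u (𝓝[>] 0) (𝓝 x))
    (hd : ∀ t ∈ Ioo 0 T, HasDerivAt u (f t) t) (ht : t ∈ Ioc 0 T) :
    u t = x + ∫ s in (0 : ℝ)..t, f s := by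
  have hleft : Tendsto u (𝓝[<] t) (𝓝 (u t)) := by
    rw [← nhdsWithin_Ioo_eq_nhdsLT ht.1]
    exact (hu t ht).mono_left <| nhdsWithin_mono _ fun s hs => ⟨hs.1, hs.2.le.trans ht.2⟩
  rw [intervalIntegral.integral_eq_sub_of_hasDerivAt_of_tendsto ht.1
    (fun s hs => hd s ⟨hs.1, hs.2.trans_le ht.2⟩) (hf.intervalIntegrable hμ ⟨ht.1.le, ht.2⟩)
    h0 hleft, add_sub_cancel]

end IsBC

end Weight

/-! ### The linear problem -/

section LinearProblem

variable {E : Type*} [NormedAddCommGroup E] [NormedSpace ℝ E]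
variable {E₀ E₁ : Type*} [NormedAddCommGroup E₀] [NormedSpace ℝ E₀]
  [NormedAddCommGroup E₁] [NormedSpace ℝ E₁]

lemma integral_ite_of_le {d d' : ℝ → E} {a t : ℝ} (ht : 0 ≤ t) (hta : t ≤ a) :
    ∫ s in (0 : ℝ)..t, (if s ≤ a then d s else d' (s - a)) = ∫ s in (0 : ℝ)..t, d s := by
  refine intervalIntegral.integral_congr fun s hs => ?_
  rw [uIcc_of_le ht] at hs
  exact if_pos (hs.2.trans hta)

lemma integral_ite_of_lt {d d' : ℝ → E} {a t : ℝ} (ha : 0 ≤ a) (hat : a < t)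
    (h : IntervalIntegrable (fun s => if s ≤ a then d s else d' (s - a)) MeasureTheory.volume 0 t) :
    ∫ s in (0 : ℝ)..t, (if s ≤ a then d s else d' (s - a)) =
      (∫ s in (0 : ℝ)..a, d s) + ∫ s in (0 : ℝ)..(t - a), d' s := by
  have hmem : a ∈ uIcc 0 t := by rw [uIcc_of_le (ha.trans hat.le)]; exact ⟨ha, hat.le⟩
  rw [← intervalIntegral.integral_add_adjacent_intervals
    (h.mono_set (uIcc_subset_uIcc_left hmem)) (h.mono_set (uIcc_subset_uIcc_right hmem)),
    integral_ite_of_le ha le_rfl]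
  congr 1
  calc ∫ s in a..t, (if s ≤ a then d s else d' (s - a)) = ∫ s in a..t, d' (s - a) := by
        refine intervalIntegral.integral_congr_uIoo fun s hs => ?_
        rw [uIoo_of_le hat.le] at hs
        exact if_neg hs.1.not_ge
    _ = ∫ s in (0 : ℝ)..(t - a), d' s := by
        rw [intervalIntegral.integral_comp_sub_right d', sub_self]

/-- `v` is the `E₁`-valued function underlying a solution in `𝔼_{1,μ}([0, T])` of `u' + B u = g`,
`u(0) = x`; the equation is written in integrated form, which needs no derivative. -/
structure IsMild (i : E₁ →L[ℝ] E₀) (μ T : ℝ) (B : E₁ →L[ℝ] E₀) (x : E₀) (g : ℝ → E₀)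
    (v : ℝ → E₁) : Prop where
  bc : IsBC μ T v
  bc_rhs : IsBC μ T g
  eq : ∀ t ∈ Ioc 0 T, i (v t) = x + ∫ s in (0 : ℝ)..t, (g s - B (v s))

namespace IsMild

variable {i B : E₁ →L[ℝ] E₀} {μ T : ℝ} {x x' : E₀} {g g' : ℝ → E₀} {v v' : ℝ → E₁}

lemma mono (h : IsMild i μ T B x g v) {T' : ℝ} (hT : T' ≤ T) : IsMild i μ T' B x g v :=
  ⟨h.bc.mono hT, h.bc_rhs.mono hT, fun t ht => h.eq t ⟨ht.1, ht.2.trans hT⟩⟩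

lemma bc_deriv (hμ : μ < 1) (hT : 0 < T) (h : IsMild i μ T B x g v) :
    IsBC μ T (fun t => g t - B (v t)) :=
  h.bc_rhs.sub hμ hT (h.bc.clm_comp hμ hT B)

lemma congr (hT : 0 < T) (h : IsMild i μ T B x g v) (hg : EqOn g' g (Ioc 0 T))
    (hv : EqOn v' v (Ioc 0 T)) : IsMild i μ T B x g' v' := by
  refine ⟨h.bc.congr hT hv, h.bc_rhs.congr hT hg, fun t ht => ?_⟩
  rw [hv ht, h.eq t ht]
  congr 1
  refine intervalIntegral.integral_congr_uIoo fun s hs => ?_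
  rw [uIoo_of_le ht.1.le] at hs
  have hs' : s ∈ Ioc 0 T := ⟨hs.1, hs.2.le.trans ht.2⟩
  simp only [hg hs', hv hs']

lemma const (hμ : μ < 1) (hT : 0 < T) (y : E₁) :
    IsMild i μ T B (i y) (fun _ => B y) (fun _ => y) :=
  ⟨isBC_const hμ hT y, isBC_const hμ hT _, fun t _ => by simp⟩

lemma zero (hμ : μ < 1) (hT : 0 < T) : IsMild i μ T B 0 (fun _ => 0) (fun _ => 0) := by
  simpa only [map_zero] using const (i := i) (B := B) hμ hT 0

lemma sub (hμ : μ ∈ Ioo 0 1) (hT : 0 < T) (h : IsMild i μ T B x g v)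
    (h' : IsMild i μ T B x' g' v') :
    IsMild i μ T B (x - x') (fun t => g t - g' t) (fun t => v t - v' t) := by
  refine ⟨h.bc.sub hμ.2 hT h'.bc, h.bc_rhs.sub hμ.2 hT h'.bc_rhs, fun t ht => ?_⟩
  have hint := (h.bc_deriv hμ.2 hT).intervalIntegrable hμ.1 ⟨ht.1.le, ht.2⟩
  have hint' := (h'.bc_deriv hμ.2 hT).intervalIntegrable hμ.1 ⟨ht.1.le, ht.2⟩
  rw [map_sub, h.eq t ht, h'.eq t ht, add_sub_add_comm, ← intervalIntegral.integral_sub hint hint']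
  congr 1
  refine intervalIntegral.integral_congr fun s _ => ?_
  simp only [map_sub]
  abel

lemma smul (hμ : μ < 1) (hT : 0 < T) (h : IsMild i μ T B x g v) (c : ℝ) :
    IsMild i μ T B (c • x) (fun t => c • g t) (fun t => c • v t) := by
  refine ⟨h.bc.const_smul hμ hT c, h.bc_rhs.const_smul hμ hT c, fun t ht => ?_⟩
  rw [map_smul, h.eq t ht, smul_add, ← intervalIntegral.integral_smul]
  simp only [map_smul, smul_sub]

lemma add (hμ : μ ∈ Ioo 0 1) (hT : 0 < T) (h : IsMild i μ T B x g v)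
    (h' : IsMild i μ T B x' g' v') :
    IsMild i μ T B (x + x') (fun t => g t + g' t) (fun t => v t + v' t) := by
  simpa using h.sub hμ hT (h'.smul hμ.2 hT (-1))

lemma tendsto (hμ : μ ∈ Ioo 0 1) (hT : 0 < T) (h : IsMild i μ T B x g v) :
    Tendsto (fun t => i (v t)) (𝓝[>] 0) (𝓝 x) := by
  have hint := ((h.bc_deriv hμ.2 hT).tendsto_integral hμ.1 hT).const_add x
  rw [add_zero] at hint
  refine hint.congr' ?_
  filter_upwards [Ioc_mem_nhdsGT hT] with t ht using (h.eq t ht).symm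

lemma glue (hμ : μ ∈ Ioo 0 1) {a : ℝ} (ha : 0 < a) (haT : a < T)
    (h : IsMild i μ a B x g v) (h' : IsMild i μ (T - a) B (i (v a)) g' v')
    (hv : Tendsto v' (𝓝[>] 0) (𝓝 (v a))) (hg : Tendsto g' (𝓝[>] 0) (𝓝 (g a))) :
    IsMild i μ T B x (fun t => if t ≤ a then g t else g' (t - a))
      (fun t => if t ≤ a then v t else v' (t - a)) := by
  have hT : 0 < T := ha.trans haT
  have bcv := h.bc.glue hμ.2 ha haT h'.bc.continuousOn hv
  have bcg := h.bc_rhs.glue hμ.2 ha haT h'.bc_rhs.continuousOn hg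
  let d (s : ℝ) := g s - B (v s)
  let d' (s : ℝ) := g' s - B (v' s)
  have hdiff : (fun s => (if s ≤ a then g s else g' (s - a)) -
      B (if s ≤ a then v s else v' (s - a))) = fun s => if s ≤ a then d s else d' (s - a) :=
    funext fun s => by split_ifs <;> rfl
  have bcd := bcg.sub hμ.2 hT (bcv.clm_comp hμ.2 hT B)
  rw [hdiff] at bcd
  refine ⟨bcv, bcg, fun t ht => ?_⟩
  rw [hdiff]
  rcases le_or_gt t a with hta | hta
  · rw [if_pos hta, integral_ite_of_le ht.1.le hta, h.eq t ⟨ht.1, hta⟩]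
  · rw [if_neg hta.not_ge, integral_ite_of_lt ha.le hta
      (bcd.intervalIntegrable hμ.1 ⟨ht.1.le, ht.2⟩), ← add_assoc, ← h.eq a ⟨ha, le_rfl⟩,
      h'.eq (t - a) ⟨sub_pos.2 hta, sub_le_sub_right ht.2 a⟩]

lemma shift (hμ : μ ∈ Ioo 0 1) {a : ℝ} (ha : 0 < a) (haT : a < T)
    (h : IsMild i μ T B x g v) :
    IsMild i μ (T - a) B (i (v a)) (fun s => g (a + s)) (fun s => v (a + s)) := by
  have hT : 0 < T := ha.trans haT
  refine ⟨h.bc.shift hμ.2 ha haT, h.bc_rhs.shift hμ.2 ha haT, fun t ht => ?_⟩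
  have hat : a + t ∈ Ioc 0 T := ⟨by linarith [ht.1], by linarith [ht.2]⟩
  have hint := (h.bc_deriv hμ.2 hT).intervalIntegrable hμ.1 (t := a) ⟨ha.le, haT.le⟩
  have hint' := (h.bc_deriv hμ.2 hT).intervalIntegrable hμ.1 ⟨hat.1.le, hat.2⟩
  rw [h.eq (a + t) hat, h.eq a ⟨ha, haT.le⟩, add_assoc,
    intervalIntegral.integral_comp_add_left (fun s => g s - B (v s)), add_zero,
    intervalIntegral.integral_add_adjacent_intervals hint (hint.symm.trans hint')]

section Deriv

variable [CompleteSpace E₀]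

lemma hasDerivWithinAt (hμ : μ ∈ Ioo 0 1) (h : IsMild i μ T B x g v) {t : ℝ}
    (ht : t ∈ Ioc 0 T) :
    HasDerivWithinAt (fun t => i (v t)) (g t - B (v t)) (Ioc 0 T) t :=
  (((h.bc_deriv hμ.2 (ht.1.trans_le ht.2)).hasDerivWithinAt_integral hμ.1 ht).const_add x).congr
    h.eq (h.eq t ht)

lemma of_hasDerivAt (hμ : μ ∈ Ioo 0 1) (hv : IsBC μ T v) (hg : IsBC μ T g)
    (h0 : Tendsto (fun t => i (v t)) (𝓝[>] 0) (𝓝 x))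
    (hd : ∀ t ∈ Ioo 0 T, HasDerivAt (fun t => i (v t)) (g t - B (v t)) t) :
    IsMild i μ T B x g v :=
  ⟨hv, hg, fun _ ht => (hg.sub hμ.2 (ht.1.trans_le ht.2)
    (hv.clm_comp hμ.2 (ht.1.trans_le ht.2) B)).eq_add_integral hμ.1
      (i.continuous.comp_continuousOn hv.continuousOn) h0 hd ht⟩

lemma isMaxRegFun (hμ : μ ∈ Ioo 0 1) (hT : 0 < T) (h : IsMild i μ T B x g v)
    {u : ℝ → E₀} (hu0 : u 0 = x) (hu : ∀ t ∈ Ioc 0 T, u t = i (v t)) :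
    IsMaxRegFun i μ T u v (fun t => g t - B (v t)) where
  lift t ht := (hu t ht).symm
  hasDeriv t ht := (h.hasDerivWithinAt hμ ht).congr hu (hu t ht)
  bc := (h.bc.clm_comp hμ.2 hT i).congr hT hu
  bc_deriv := h.bc_deriv hμ.2 hT
  bc_lift := h.bc
  trace := by
    rw [hu0]
    refine (h.tendsto hμ hT).congr' ?_
    filter_upwards [Ioc_mem_nhdsGT hT] with t ht using (hu t ht).symm

lemma isLinearSolution (hμ : μ ∈ Ioo 0 1) (hT : 0 < T) (h : IsMild i μ T B x g v) :
    IsLinearSolution i μ T B g x (fun t => if t = 0 then x else i (v t)) :=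
  ⟨v, _, h.isMaxRegFun hμ hT (if_pos rfl) fun _ ht => if_neg ht.1.ne', if_pos rfl,
    fun _ _ => sub_add_cancel _ _⟩

variable [CompleteSpace E₁]

lemma apply_eq (hμ : μ ∈ Ioo 0 1) (h : IsMild i μ T B x g v) {t : ℝ} (ht : t ∈ Ioc 0 T) :
    i (v t) = x + (∫ s in (0 : ℝ)..t, g s) - B (∫ s in (0 : ℝ)..t, v s) := by
  have hT := ht.1.trans_le ht.2
  have ht' : t ∈ Icc 0 T := ⟨ht.1.le, ht.2⟩
  rw [h.eq t ht, intervalIntegral.integral_sub (h.bc_rhs.intervalIntegrable hμ.1 ht')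
    ((h.bc.clm_comp hμ.2 hT B).intervalIntegrable hμ.1 ht'),
    B.intervalIntegral_comp_comm (h.bc.intervalIntegrable hμ.1 ht'), add_sub_assoc]

lemma integral (hμ : μ ∈ Ioo 0 1) (hT : 0 < T) (h : IsMild i μ T B x g v) :
    IsMild i μ T B 0 (fun t => x + ∫ s in (0 : ℝ)..t, g s) (fun t => ∫ s in (0 : ℝ)..t, v s) := by
  refine ⟨isBC_of_continuousOn hμ.2 hT (h.bc.continuousOn_integral hμ.1 hT.le),
    isBC_of_continuousOn hμ.2 hT
      (continuousOn_const.add (h.bc_rhs.continuousOn_integral hμ.1 hT.le)), fun t ht => ?_⟩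
  rw [← i.intervalIntegral_comp_comm (h.bc.intervalIntegrable hμ.1 ⟨ht.1.le, ht.2⟩), zero_add]
  refine intervalIntegral.integral_congr_uIoo fun s hs => ?_
  rw [uIoo_of_le ht.1.le] at hs
  exact h.apply_eq hμ ⟨hs.1, hs.2.le.trans ht.2⟩

end Deriv

end IsMild

variable {i B : E₁ →L[ℝ] E₀} {μ T : ℝ}

lemma IsMaxRegFun.isMild [CompleteSpace E₀] (hμ : μ ∈ Ioo 0 1) (hT : 0 < T) {u u' : ℝ → E₀}
    {v : ℝ → E₁} (h : IsMaxRegFun i μ T u v u') :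
    IsMild i μ T B (u 0) (fun t => u' t + B (v t)) v := by
  refine .of_hasDerivAt hμ h.bc_lift (h.bc_deriv.add hμ.2 hT (h.bc_lift.clm_comp hμ.2 hT B))
    (h.trace.congr' ?_) fun t ht => ?_
  · filter_upwards [Ioc_mem_nhdsGT hT] with t ht using (h.lift t ht).symm
  · have hnhds : Ioc 0 T ∈ 𝓝 t := Ioc_mem_nhds ht.1 ht.2
    rw [add_sub_cancel_right]
    refine ((h.hasDeriv t ⟨ht.1, ht.2.le⟩).hasDerivAt hnhds).congr_of_eventuallyEq ?_
    filter_upwards [hnhds] with s hs using h.lift s hs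

/-- Unique solvability of the linear problem on `[0, T]`, in integrated form. -/
structure MildSolvable (i : E₁ →L[ℝ] E₀) (μ T : ℝ) (B : E₁ →L[ℝ] E₀) : Prop where
  exists_sol : ∀ x ∈ interpSpace i μ, ∀ g, IsBC μ T g → ∃ v, IsMild i μ T B x g v
  unique : ∀ v, IsMild i μ T B 0 (fun _ => 0) v → ∀ t ∈ Ioc 0 T, v t = 0

lemma exists_mildSolvable [CompleteSpace E₀] (hi : Function.Injective i)
    (hμ : μ ∈ Ioo 0 1) (hB : B ∈ maxRegClass i μ) : ∃ T > 0, MildSolvable i μ T B := by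
  obtain ⟨T, hT, h⟩ := hB
  refine ⟨T, hT, fun x hx g hg => ?_, fun v hv t ht => ?_⟩
  · obtain ⟨u, v, u', hu, rfl, he⟩ := (h g hg x hx).1
    exact ⟨v, (hu.isMild (B := B) hμ hT).congr hT (fun t ht => (he t ht).symm) fun _ _ => rfl⟩
  · have heq := (h _ (isBC_const hμ.2 hT 0) 0 (zero_mem_interpSpace hμ.2)).2 _ _
      (hv.isLinearSolution hμ hT) ((IsMild.zero hμ.2 hT).isLinearSolution hμ hT) ⟨ht.1.le, ht.2⟩
    simp only [if_neg ht.1.ne'] at heq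
    exact hi heq

namespace MildSolvable

lemma exists_sol_of_le (hμ : μ < 1) (h : MildSolvable i μ T B) {τ : ℝ} (hτ : τ ∈ Ioc 0 T)
    {x : E₀} (hx : x ∈ interpSpace i μ) {g : ℝ → E₀} (hg : IsBC μ τ g) :
    ∃ v, IsMild i μ τ B x g v := by
  obtain ⟨g', hg', heq, -⟩ := hg.exists_extend hμ hτ
  obtain ⟨v, hv⟩ := h.exists_sol x hx g' hg'
  exact ⟨v, (hv.mono hτ.2).congr hτ.1 heq.symm fun _ _ => rfl⟩

variable [CompleteSpace E₀] [CompleteSpace E₁]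

lemma exists_isMild_extend_integral (hμ : μ ∈ Ioo 0 1) (h : MildSolvable i μ T B) {τ : ℝ}
    (hτ : 0 < τ) (hτT : τ < T) {v : ℝ → E₁} (hv : IsMild i μ τ B 0 (fun _ => 0) v) :
    ∃ w, IsMild i μ T B 0 (fun _ => 0) w ∧
      EqOn w (fun t => ∫ s in (0 : ℝ)..t, v s) (Ioc 0 τ) := by
  have hTτ : 0 < T - τ := sub_pos.2 hτT
  set V : ℝ → E₁ := fun t => ∫ s in (0 : ℝ)..t, v s
  have hV : IsMild i μ τ B 0 (fun _ => 0) V :=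
    (hv.integral hμ hτ).congr hτ (fun t _ => by simp) fun _ _ => rfl
  -- `v` may not extend beyond `τ`, but the problem restarted from `v τ` can be solved and
  -- integrated; integrals are continuous at `0`, so the pieces can be glued.
  obtain ⟨ζ, hζT⟩ := h.exists_sol (i (v τ)) (apply_mem_interpSpace hμ.2 _) (fun _ => 0)
    (isBC_const hμ.2 (hτ.trans hτT) 0)
  have hζ := hζT.mono (sub_le_self T hτ.le)
  have hvτ : i (v τ) = - B (V τ) := by simpa using hv.apply_eq hμ ⟨hτ, le_rfl⟩
  have hnext : IsMild i μ (T - τ) B (i (V τ)) (fun _ => 0)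
      (fun t => V τ + ∫ s in (0 : ℝ)..t, ζ s) := by
    have hsum := (IsMild.const (i := i) (B := B) hμ.2 hTτ (V τ)).add hμ hTτ (hζ.integral hμ hTτ)
    rw [add_zero] at hsum
    exact hsum.congr hTτ (fun t _ => by simp [hvτ]) fun _ _ => rfl
  have hlim : Tendsto (fun t => V τ + ∫ s in (0 : ℝ)..t, ζ s) (𝓝[>] 0) (𝓝 (V τ)) := by
    simpa only [add_zero] using (hζ.bc.tendsto_integral hμ.1 hTτ).const_add (V τ)
  refine ⟨_, (hV.glue hμ hτ hτT hnext hlim tendsto_const_nhds).congr (hτ.trans hτT)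
    (fun t _ => (ite_self _).symm) fun _ _ => rfl, fun t ht => if_pos ht.2⟩

lemma eq_zero (hi : Function.Injective i) (hμ : μ ∈ Ioo 0 1) (h : MildSolvable i μ T B) {τ : ℝ}
    (hτT : τ ≤ T) {v : ℝ → E₁} (hv : IsMild i μ τ B 0 (fun _ => 0) v) {t : ℝ}
    (ht : t ∈ Ioc 0 τ) : v t = 0 := by
  rcases hτT.eq_or_lt with rfl | hlt
  · exact h.unique v hv t ht
  obtain ⟨w, hw, hwv⟩ := h.exists_isMild_extend_integral hμ (ht.1.trans_le ht.2) hlt hv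
  have hint : ∫ s in (0 : ℝ)..t, v s = 0 :=
    (hwv ht).symm.trans (h.unique w hw t ⟨ht.1, ht.2.trans hτT⟩)
  exact hi (by simpa [hint] using hv.apply_eq hμ ht)

lemma eqOn (hi : Function.Injective i) (hμ : μ ∈ Ioo 0 1) (h : MildSolvable i μ T B)
    {τ : ℝ} (hτ : τ ∈ Ioc 0 T) {x : E₀} {g : ℝ → E₀} {v v' : ℝ → E₁}
    (hv : IsMild i μ τ B x g v) (hv' : IsMild i μ τ B x g v') : EqOn v v' (Ioc 0 τ) :=
  fun t ht => by
    have hsub := hv.sub hμ hτ.1 hv'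
    simp only [sub_self] at hsub
    exact sub_eq_zero.1 (h.eq_zero hi hμ hτ.2 hsub ht)

end MildSolvable

end LinearProblem

section ClosedGraph

variable {E : Type*} [NormedAddCommGroup E] [NormedSpace ℝ E] {μ T t : ℝ} {hT : 0 ≤ T}

/-- The continuous functions on `[0, T]` vanishing at `0`. The map `f ↦ t ^ (1 - μ) f(t)`
identifies `BC_{1-μ}([0, T], E)` with this Banach space; `unweight` is the inverse. -/
abbrev VanishingAtZero (E : Type*) [NormedAddCommGroup E] [NormedSpace ℝ E] (hT : 0 ≤ T) :
    Submodule ℝ C(Icc 0 T, E) :=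
  (ContinuousMap.evalCLM ℝ (⟨0, le_rfl, hT⟩ : Icc 0 T)).ker

/-- The function `t ^ (μ - 1) γ(t)` on `(0, T]`. -/
noncomputable def unweight (μ : ℝ) (γ : VanishingAtZero E hT) : ℝ → E :=
  fun t => t ^ (μ - 1) • γ.1 (projIcc 0 T hT t)

lemma unweight_add (γ γ' : VanishingAtZero E hT) (t : ℝ) :
    unweight μ (γ + γ') t = unweight μ γ t + unweight μ γ' t :=
  smul_add _ _ _

lemma unweight_smul (c : ℝ) (γ : VanishingAtZero E hT) (t : ℝ) :
    unweight μ (c • γ) t = c • unweight μ γ t :=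
  smul_comm _ _ _

lemma unweight_sub (γ γ' : VanishingAtZero E hT) (t : ℝ) :
    unweight μ (γ - γ') t = unweight μ γ t - unweight μ γ' t :=
  smul_sub _ _ _

lemma continuous_unweight_apply (t : ℝ) :
    Continuous fun γ : VanishingAtZero E hT => unweight μ γ t :=
  ((continuous_eval_const _).comp continuous_subtype_val).const_smul _

lemma rpow_smul_unweight (ht : t ∈ Ioc 0 T) (γ : VanishingAtZero E hT) :
    t ^ (1 - μ) • unweight μ γ t = γ.1 (projIcc 0 T hT t) := by
  rw [unweight, smul_smul, mul_comm, rpow_sub_one_mul_rpow_one_sub ht.1, one_smul]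

lemma isBC_unweight (hμ : μ < 1) (hT' : 0 < T) (γ : VanishingAtZero E hT) :
    IsBC μ T (unweight μ γ) := by
  have hcont : Continuous fun t => γ.1 (projIcc 0 T hT t) := γ.1.continuous.comp continuous_projIcc
  refine (isBC_iff hμ hT').2 <| hcont.continuousOn.congr fun t ht => ?_
  rcases ht.1.eq_or_lt with rfl | ht0
  · have hγ : γ.1 ⟨0, le_rfl, hT⟩ = 0 := γ.2
    simp [Real.zero_rpow (sub_pos.2 hμ).ne', hγ]
  · exact rpow_smul_unweight ⟨ht0, ht.2⟩ γ

lemma weightedBound_unweight (γ : VanishingAtZero E hT) :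
    WeightedBound μ T (unweight μ γ) ‖γ‖ := fun t ht => by
  rw [← norm_rpow_smul ht.1.le, rpow_smul_unweight ht]
  exact γ.1.norm_coe_le_norm _

lemma norm_le_of_weightedBound_unweight (hT' : 0 < T) {γ : VanishingAtZero E hT} {M : ℝ}
    (h : WeightedBound μ T (unweight μ γ) M) : ‖γ‖ ≤ M := by
  refine (ContinuousMap.norm_le γ.1 (h.nonneg hT')).2 fun t => ?_
  rcases t.2.1.eq_or_lt with ht | ht
  · have hγ : γ.1 ⟨0, le_rfl, hT⟩ = 0 := γ.2
    rw [show t = ⟨0, le_rfl, hT⟩ from Subtype.ext ht.symm, hγ, norm_zero]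
    exact h.nonneg hT'
  · have ht' : t.1 ∈ Ioc 0 T := ⟨ht, t.2.2⟩
    have hM := h t ht'
    rwa [← norm_rpow_smul ht.le, rpow_smul_unweight ht', projIcc_val] at hM

lemma IsBC.exists_unweight (hμ : μ < 1) (hT' : 0 < T) {f : ℝ → E} (hf : IsBC μ T f) :
    ∃ γ : VanishingAtZero E hT, EqOn (unweight μ γ) f (Ioc 0 T) := by
  let γ : C(Icc 0 T, E) :=
    ⟨_, continuousOn_iff_continuous_domRestrict.1 ((isBC_iff hμ hT').1 hf)⟩
  have hγ (t : Icc 0 T) : γ t = t.1 ^ (1 - μ) • f t := rfl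
  have hγ0 : γ ⟨0, le_rfl, hT⟩ = 0 := by
    rw [hγ, Real.zero_rpow (sub_pos.2 hμ).ne', zero_smul]
  refine ⟨⟨γ, hγ0⟩, fun t ht => ?_⟩
  rw [unweight, projIcc_of_mem hT ⟨ht.1.le, ht.2⟩, hγ, smul_smul,
    rpow_sub_one_mul_rpow_one_sub ht.1, one_smul]

lemma continuous_integral_unweight (hμ : μ ∈ Ioo 0 1) (ht : t ∈ Ioc 0 T) :
    Continuous fun γ : VanishingAtZero E hT => ∫ s in (0 : ℝ)..t, unweight μ γ s := by
  have hlin : IsLinearMap ℝ fun γ : VanishingAtZero E hT => ∫ s in (0 : ℝ)..t, unweight μ γ s := by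
    have hint (γ : VanishingAtZero E hT) :=
      (isBC_unweight hμ.2 (ht.1.trans_le ht.2) γ).intervalIntegrable hμ.1 ⟨ht.1.le, ht.2⟩
    constructor
    · intro γ γ'
      simp only [unweight_add]
      exact intervalIntegral.integral_add (hint γ) (hint γ')
    · intro c γ
      simp only [unweight_smul]
      exact intervalIntegral.integral_smul _ _
  refine (hlin.with_bound (t ^ μ / μ) fun γ => ?_).continuous
  exact (((weightedBound_unweight γ).mono ht.2).norm_integral_le hμ.1 ht.1.le).trans_eq
    (mul_div_right_comm _ _ _)

variable {E₀ E₁ : Type*} [NormedAddCommGroup E₀] [NormedSpace ℝ E₀]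
  [NormedAddCommGroup E₁] [NormedSpace ℝ E₁]

/-- The graph of the solution operator `g ↦ v` of `u' + B u = g`, `u(0) = 0`, transported to
`VanishingAtZero`. -/
def solutionGraph (i B : E₁ →L[ℝ] E₀) (hμ : μ ∈ Ioo 0 1) (hT : 0 < T) :
    Submodule ℝ (VanishingAtZero E₀ hT.le × VanishingAtZero E₁ hT.le) where
  carrier := {p | IsMild i μ T B 0 (unweight μ p.1) (unweight μ p.2)}
  add_mem' {p q} hp hq := by
    have hadd := IsMild.add hμ hT hp hq
    rw [add_zero] at hadd
    exact hadd.congr hT (fun t _ => unweight_add _ _ t) fun t _ => unweight_add _ _ t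
  zero_mem' := (IsMild.zero hμ.2 hT).congr hT (fun _ _ => smul_zero _) fun _ _ => smul_zero _
  smul_mem' c p hp := by
    have hsmul := IsMild.smul hμ.2 hT hp c
    rw [smul_zero] at hsmul
    exact hsmul.congr hT (fun t _ => unweight_smul c _ t) fun t _ => unweight_smul c _ t

variable {i B : E₁ →L[ℝ] E₀} [CompleteSpace E₀] [CompleteSpace E₁]

lemma mem_solutionGraph_iff (hμ : μ ∈ Ioo 0 1) (hT : 0 < T)
    (p : VanishingAtZero E₀ hT.le × VanishingAtZero E₁ hT.le) :
    p ∈ solutionGraph i B hμ hT ↔ ∀ t ∈ Ioc 0 T, i (unweight μ p.2 t) =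
      (∫ s in (0 : ℝ)..t, unweight μ p.1 s) - B (∫ s in (0 : ℝ)..t, unweight μ p.2 s) := by
  have bcg := isBC_unweight hμ.2 hT p.1
  have bcv := isBC_unweight hμ.2 hT p.2
  refine ⟨fun h t ht => by simpa only [zero_add] using h.apply_eq hμ ht,
    fun h => ⟨bcv, bcg, fun t ht => ?_⟩⟩
  have ht' : t ∈ Icc 0 T := ⟨ht.1.le, ht.2⟩
  rw [h t ht, zero_add, intervalIntegral.integral_sub (bcg.intervalIntegrable hμ.1 ht')
    ((bcv.clm_comp hμ.2 hT B).intervalIntegrable hμ.1 ht'),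
    B.intervalIntegral_comp_comm (bcv.intervalIntegrable hμ.1 ht')]

lemma isClosed_solutionGraph (hμ : μ ∈ Ioo 0 1) (hT : 0 < T) :
    IsClosed (solutionGraph i B hμ hT :
      Set (VanishingAtZero E₀ hT.le × VanishingAtZero E₁ hT.le)) := by
  have hset : (solutionGraph i B hμ hT : Set (_ × _)) = {p | ∀ t ∈ Ioc 0 T,
      i (unweight μ p.2 t) =
        (∫ s in (0 : ℝ)..t, unweight μ p.1 s) - B (∫ s in (0 : ℝ)..t, unweight μ p.2 s)} :=
    Set.ext fun p => mem_solutionGraph_iff hμ hT p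
  simp only [hset, Set.ofPred_forall]
  refine isClosed_biInter fun t ht => isClosed_eq ?_ (.sub ?_ ?_)
  · exact i.continuous.comp ((continuous_unweight_apply t).comp continuous_snd)
  · exact (continuous_integral_unweight hμ ht).comp continuous_fst
  · exact B.continuous.comp ((continuous_integral_unweight hμ ht).comp continuous_snd)

namespace MildSolvable

/-- The open mapping theorem for the projection of the (closed) solution graph to the right-hand
sides. -/
lemma exists_isMild_weightedBound (hμ : μ ∈ Ioo 0 1) (hT : 0 < T) (h : MildSolvable i μ T B) :
    ∃ M > 0, ∀ g, IsBC μ T g → ∀ G, WeightedBound μ T g G →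
      ∃ v, IsMild i μ T B 0 g v ∧ WeightedBound μ T v (M * G) := by
  let Γ := solutionGraph i B hμ hT
  have : CompleteSpace Γ := (isClosed_solutionGraph hμ hT).completeSpace_coe
  let π : Γ →L[ℝ] VanishingAtZero E₀ hT.le := (ContinuousLinearMap.fst ℝ _ _).comp Γ.subtypeL
  have hsurj : Function.Surjective π := fun γ => by
    obtain ⟨v, hv⟩ := h.exists_sol 0 (zero_mem_interpSpace hμ.2) _ (isBC_unweight hμ.2 hT γ)
    obtain ⟨φ, hφ⟩ := hv.bc.exists_unweight (hT := hT.le) hμ.2 hT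
    exact ⟨⟨(γ, φ), hv.congr hT (fun _ _ => rfl) hφ⟩, rfl⟩
  obtain ⟨M, hM, hbound⟩ := ContinuousLinearMap.exists_preimage_norm_le
    (E := Γ) (F := VanishingAtZero E₀ hT.le) (σ := .id ℝ) (σ' := .id ℝ) π hsurj
  refine ⟨M, hM, fun g hg G hG => ?_⟩
  obtain ⟨γ, hγ⟩ := hg.exists_unweight (hT := hT.le) hμ.2 hT
  obtain ⟨⟨⟨_, φ⟩, hp⟩, rfl, hφ⟩ := hbound γ
  refine ⟨unweight μ φ, hp.congr hT hγ.symm fun _ _ => rfl, fun t ht => ?_⟩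
  calc t ^ (1 - μ) * ‖unweight μ φ t‖ ≤ ‖φ‖ := weightedBound_unweight φ t ht
    _ ≤ M * _ := (norm_snd_le _).trans hφ
    _ ≤ M * G := by gcongr; exact norm_le_of_weightedBound_unweight hT (hG.congr hγ)

lemma exists_bound (hi : Function.Injective i) (hμ : μ ∈ Ioo 0 1) (hT : 0 < T)
    (h : MildSolvable i μ T B) :
    ∃ M > 0, ∀ τ ∈ Ioc 0 T, ∀ g v, IsMild i μ τ B 0 g v → ∀ G,
      WeightedBound μ τ g G → WeightedBound μ τ v (M * G) := by
  obtain ⟨M, hM, hbound⟩ := h.exists_isMild_weightedBound hμ hT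
  refine ⟨M, hM, fun τ hτ g v hv G hG => ?_⟩
  obtain ⟨g', hg', heq, hle⟩ := hv.bc_rhs.exists_extend hμ.2 hτ
  obtain ⟨v', hv', hv'G⟩ := hbound g' hg' G (hle G hG)
  have hrestrict := (hv'.mono hτ.2).congr hτ.1 heq.symm fun _ _ => rfl
  exact (hv'G.mono hτ.2).congr (h.eqOn hi hμ hτ hv hrestrict)

end MildSolvable

end ClosedGraph

/-! ### Smoothing estimates for the linear problem -/

section LinearEstimates

variable {E₀ E₁ : Type*} [NormedAddCommGroup E₀] [NormedSpace ℝ E₀]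
  [NormedAddCommGroup E₁] [NormedSpace ℝ E₁] {i B : E₁ →L[ℝ] E₀} {μ ν T t s G : ℝ} {x : E₀}
  {g : ℝ → E₀} {v : ℝ → E₁}

lemma le_mul_interpNorm_add (hν : 0 ≤ ν) (hx : x ∈ interpSpace i ν) (ht : 0 < t) {c C : ℝ}
    (hC : 0 ≤ C) (h : ∀ y, c ≤ C * (‖x - i y‖ + t * ‖y‖ + t ^ ν * G)) :
    c ≤ C * (t ^ ν * (interpNorm i ν x + G)) := by
  have hK : c - C * (t ^ ν * G) ≤ C * kFunctional i t x :=
    le_mul_kFunctional hC fun y => by rw [sub_le_iff_le_add, ← mul_add]; exact h y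
  calc c ≤ C * kFunctional i t x + C * (t ^ ν * G) := sub_le_iff_le_add.1 hK
    _ ≤ C * (t ^ ν * interpNorm i ν x) + C * (t ^ ν * G) := by
        gcongr
        exact kFunctional_le_interpNorm hν hx ht
    _ = C * (t ^ ν * (interpNorm i ν x + G)) := by ring

lemma WeightedBound.mul_norm_sub_le (hν : 0 < ν) (hG : WeightedBound ν t g G) (hs : s ∈ Ioc 0 t)
    (y : E₁) : s * ‖g s - B y‖ ≤ (1 + ‖B‖) * (t * ‖y‖ + t ^ ν * G) := by
  have hs0 := hs.1
  have hG0 : 0 ≤ G := hG.nonneg (hs0.trans_le hs.2)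
  calc s * ‖g s - B y‖ ≤ s * (‖g s‖ + ‖B‖ * ‖y‖) := by
        gcongr
        exact norm_sub_le_of_le le_rfl (B.le_opNorm y)
    _ = s * ‖g s‖ + ‖B‖ * (s * ‖y‖) := by ring
    _ ≤ s ^ ν * G + ‖B‖ * (s * ‖y‖) := by grw [hG.mul_norm_le hs]
    _ ≤ t ^ ν * G + ‖B‖ * (t * ‖y‖) := by grw [hs.2]
    _ ≤ (1 + ‖B‖) * (t * ‖y‖ + t ^ ν * G) := by
        have hy : 0 ≤ t * ‖y‖ := mul_nonneg (hs0.le.trans hs.2) (norm_nonneg y)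
        have hBG : 0 ≤ ‖B‖ * (t ^ ν * G) :=
          mul_nonneg (norm_nonneg B) (mul_nonneg (Real.rpow_nonneg (hs0.le.trans hs.2) ν) hG0)
        linarith

variable [CompleteSpace E₀]

lemma WeightedBound.norm_sub_add_integral_le (hν : 0 < ν) (hG : WeightedBound ν t g G)
    (hg : IntervalIntegrable g MeasureTheory.volume 0 s) (hs : s ∈ Ioc 0 t) (x : E₀) (y : E₁) :
    ‖x - i y + ∫ r in (0 : ℝ)..s, (g r - B y)‖ ≤
      (1 + ‖B‖ + 1 / ν) * (‖x - i y‖ + t * ‖y‖ + t ^ ν * G) := by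
  have ht0 : 0 < t := hs.1.trans_le hs.2
  have hG0 : 0 ≤ G := hG.nonneg ht0
  have hint : ‖∫ r in (0 : ℝ)..s, g r‖ ≤ t ^ ν * G / ν :=
    ((hG.mono hs.2).norm_integral_le hν hs.1.le).trans <| by
      gcongr
      exacts [hs.1.le, hs.2]
  have hBy : ‖s • B y‖ ≤ t * (‖B‖ * ‖y‖) := by
    rw [norm_smul, Real.norm_of_nonneg hs.1.le]
    gcongr
    exacts [hs.2, B.le_opNorm y]
  rw [intervalIntegral.integral_sub hg (by simp), intervalIntegral.integral_const, sub_zero]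
  calc ‖x - i y + ((∫ r in (0 : ℝ)..s, g r) - s • B y)‖
      ≤ ‖x - i y‖ + (t ^ ν * G / ν + t * (‖B‖ * ‖y‖)) :=
        norm_add_le_of_le le_rfl (norm_sub_le_of_le hint hBy)
    _ ≤ ‖x - i y‖ + (t ^ ν * G / ν + t * (‖B‖ * ‖y‖)) +
          ((‖B‖ + 1 / ν) * ‖x - i y‖ + (1 + 1 / ν) * (t * ‖y‖) + (1 + ‖B‖) * (t ^ ν * G)) :=
        le_add_of_nonneg_right (by positivity)
    _ = (1 + ‖B‖ + 1 / ν) * (‖x - i y‖ + t * ‖y‖ + t ^ ν * G) := by ring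

lemma IsMild.smul_id (hμ : μ ∈ Ioo 0 1) (hT : 0 < T) (hv : IsMild i μ T B x g v) :
    IsMild i μ T B 0 (fun s => i (v s) + s • g s) (fun s => s • v s) := by
  have hid : ContinuousOn (fun s : ℝ => s) (Icc 0 T) := continuousOn_id
  refine .of_hasDerivAt hμ (hv.bc.smul hμ.2 hT hid)
    ((hv.bc.clm_comp hμ.2 hT i).add hμ.2 hT (hv.bc_rhs.smul hμ.2 hT hid)) ?_ fun s hs => ?_
  · have h0 : Tendsto (fun s : ℝ => s) (𝓝[>] 0) (𝓝 0) := tendsto_id.mono_left nhdsWithin_le_nhds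
    simpa using h0.smul (hv.tendsto hμ hT)
  · have hd := (hasDerivAt_id s).smul
      ((hv.hasDerivWithinAt hμ ⟨hs.1, hs.2.le⟩).hasDerivAt (Ioc_mem_nhds hs.1 hs.2))
    simp only [map_smul]
    refine hd.congr_deriv ?_
    simp only [smul_sub, id, one_smul]
    abel

variable [CompleteSpace E₁]

namespace MildSolvable

lemma exists_norm_le (hi : Function.Injective i) (hμ : μ ∈ Ioo 0 1) (hT : 0 < T)
    (h : MildSolvable i μ T B) :
    ∃ M > 0, ∀ t ∈ Ioc 0 T, ∀ g v, IsMild i μ t B 0 g v →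
      ∀ G, (∀ s ∈ Ioc 0 t, ‖g s‖ ≤ G) → ‖v t‖ ≤ M * G := by
  obtain ⟨M, hM, hbound⟩ := h.exists_bound hi hμ hT
  refine ⟨M, hM, fun t ht g v hv G hG => ?_⟩
  have hw : WeightedBound μ t g (t ^ (1 - μ) * G) := fun s hs => by
    gcongr
    exacts [Real.rpow_nonneg ht.1.le _, hs.1.le, sub_nonneg.2 hμ.2.le, hs.2, hG s hs]
  have hv' := hbound t ht g v hv _ hw t ⟨ht.1, le_rfl⟩
  rw [mul_left_comm] at hv'
  exact le_of_mul_le_mul_left hv' (Real.rpow_pos_of_pos ht.1 _)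

/-- The time integral of `v - y` solves a linear problem whose right-hand side is controlled without
any weight. -/
lemma exists_norm_apply_sub_le (hi : Function.Injective i) (hμ : μ ∈ Ioo 0 1) (hT : 0 < T)
    (h : MildSolvable i μ T B) (hν : 0 < ν) :
    ∃ C > 0, ∀ t ∈ Ioc 0 T, ∀ x g v, IsMild i μ t B x g v → ∀ G, WeightedBound ν t g G →
      ∀ y, ‖i (v t) - i y‖ ≤ C * (‖x - i y‖ + t * ‖y‖ + t ^ ν * G) := by
  obtain ⟨M, hM, hbound⟩ := h.exists_norm_le hi hμ hT
  set c := 1 + ‖B‖ + 1 / ν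
  refine ⟨c + ‖B‖ * (M * c), by positivity, fun t ht x g v hv G hG y => ?_⟩
  set P := ‖x - i y‖ + t * ‖y‖ + t ^ ν * G
  have htt : t ∈ Ioc 0 t := ⟨ht.1, le_rfl⟩
  have hsub := hv.sub hμ ht.1 (IsMild.const (i := i) (B := B) hμ.2 ht.1 y)
  have hrhs : ∀ s ∈ Ioc 0 t, ‖x - i y + ∫ r in (0 : ℝ)..s, (g r - B y)‖ ≤ c * P := fun s hs =>
    hG.norm_sub_add_integral_le hν (hv.bc_rhs.intervalIntegrable hμ.1 ⟨hs.1.le, hs.2⟩) hs x y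
  have hint : ‖∫ s in (0 : ℝ)..t, (v s - y)‖ ≤ M * (c * P) :=
    hbound t ht _ _ (hsub.integral hμ ht.1) _ hrhs
  calc ‖i (v t) - i y‖
      = ‖x - i y + (∫ r in (0 : ℝ)..t, (g r - B y)) - B (∫ s in (0 : ℝ)..t, (v s - y))‖ := by
        rw [← map_sub, hsub.apply_eq hμ htt]
    _ ≤ c * P + ‖B‖ * (M * (c * P)) :=
        norm_sub_le_of_le (hrhs t htt) (B.le_opNorm_of_le hint)
    _ = (c + ‖B‖ * (M * c)) * P := by ring

/-- `t (v(t) - y)` solves a linear problem whose right-hand side involves `v - y` only in `E₀`. -/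
lemma exists_mul_norm_le (hi : Function.Injective i) (hμ : μ ∈ Ioo 0 1) (hT : 0 < T)
    (h : MildSolvable i μ T B) (hν : 0 < ν) :
    ∃ C > 0, ∀ t ∈ Ioc 0 T, ∀ x g v, IsMild i μ t B x g v → ∀ G, WeightedBound ν t g G →
      ∀ y, t * ‖v t‖ ≤ C * (‖x - i y‖ + t * ‖y‖ + t ^ ν * G) := by
  obtain ⟨M, hM, hbound⟩ := h.exists_norm_le hi hμ hT
  obtain ⟨C, hC, hsub⟩ := h.exists_norm_apply_sub_le hi hμ hT hν
  refine ⟨M * (C + (1 + ‖B‖)) + 1, by positivity, fun t ht x g v hv G hG y => ?_⟩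
  have ht0 := ht.1
  have hG0 : 0 ≤ t ^ ν * G := mul_nonneg (Real.rpow_nonneg ht0.le _) (hG.nonneg ht0)
  set P := ‖x - i y‖ + t * ‖y‖ + t ^ ν * G with hP
  have hyP : t * ‖y‖ + t ^ ν * G ≤ P := by
    rw [hP, add_assoc]
    exact le_add_of_nonneg_left (norm_nonneg _)
  have hrhs : ∀ s ∈ Ioc 0 t, ‖i (v s - y) + s • (g s - B y)‖ ≤ (C + (1 + ‖B‖)) * P := by
    intro s hs
    have hs0 := hs.1
    have hmono : s ^ ν ≤ t ^ ν := Real.rpow_le_rpow hs0.le hs.2 hν.le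
    have hval : ‖i (v s - y)‖ ≤ C * P := by
      rw [map_sub]
      refine (hsub s ⟨hs0, hs.2.trans ht.2⟩ x g v (hv.mono hs.2) G (hG.mono hs.2) y).trans ?_
      rw [hP]
      gcongr
      exacts [hs.2, hG.nonneg ht0]
    have hg : s * ‖g s - B y‖ ≤ (1 + ‖B‖) * P := by grw [hG.mul_norm_sub_le hν hs y, hyP]
    rw [add_mul]
    refine norm_add_le_of_le hval ?_
    rwa [norm_smul, Real.norm_of_nonneg hs0.le]
  have hm := (hv.sub hμ ht0 (IsMild.const (i := i) (B := B) hμ.2 ht0 y)).smul_id hμ ht0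
  have hvy : t * ‖v t - y‖ ≤ M * ((C + (1 + ‖B‖)) * P) := by
    simpa only [norm_smul, Real.norm_of_nonneg ht0.le] using hbound t ht _ _ hm _ hrhs
  calc t * ‖v t‖ ≤ t * (‖v t - y‖ + ‖y‖) := by
        gcongr
        simpa using norm_add_le (v t - y) y
    _ ≤ M * ((C + (1 + ‖B‖)) * P) + P := by
        rw [mul_add]
        exact add_le_add hvy (le_of_add_le_of_nonneg_left hyP hG0)
    _ = (M * (C + (1 + ‖B‖)) + 1) * P := by ring

lemma exists_rpow_mul_norm_le (hi : Function.Injective i) (hμ : μ ∈ Ioo 0 1) (hT : 0 < T)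
    (h : MildSolvable i μ T B) (hν : 0 < ν) :
    ∃ C > 0, ∀ t ∈ Ioc 0 T, ∀ x ∈ interpSpace i ν, ∀ g v, IsMild i μ t B x g v →
      ∀ G, WeightedBound ν t g G → t ^ (1 - ν) * ‖v t‖ ≤ C * (interpNorm i ν x + G) := by
  obtain ⟨C, hC, hbound⟩ := h.exists_mul_norm_le hi hμ hT hν
  refine ⟨C, hC, fun t ht x hx g v hv G hG => ?_⟩
  have ht0 := ht.1
  have hK : t * ‖v t‖ ≤ C * (t ^ ν * (interpNorm i ν x + G)) :=
    le_mul_interpNorm_add hν.le hx ht0 hC.le (hbound t ht x g v hv G hG)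
  have hsplit : t = t ^ ν * t ^ (1 - ν) := by
    rw [← Real.rpow_add ht0, add_sub_cancel, Real.rpow_one]
  refine le_of_mul_le_mul_left ?_ (Real.rpow_pos_of_pos ht0 ν)
  rw [← mul_assoc, ← hsplit, mul_left_comm]
  exact hK

lemma exists_kFunctional_le (hi : Function.Injective i) (hμ : μ ∈ Ioo 0 1) (hT : 0 < T)
    (h : MildSolvable i μ T B) (hν : 0 < ν) :
    ∃ C > 0, ∀ t ∈ Ioc 0 T, ∀ x ∈ interpSpace i ν, ∀ g v, IsMild i μ t B x g v →
      ∀ G, WeightedBound ν t g G → ∀ s ≥ t,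
        kFunctional i s (i (v t)) ≤ s ^ ν * (C * (interpNorm i ν x + G)) := by
  obtain ⟨C, hC, hbound⟩ := h.exists_norm_apply_sub_le hi hμ hT hν
  refine ⟨C + 1, by positivity, fun t ht x hx g v hv G hG s hs => ?_⟩
  have ht0 := ht.1
  have hs0 : 0 < s := ht0.trans_le hs
  have hG0 : 0 ≤ G := hG.nonneg ht0
  rw [mul_left_comm]
  refine le_mul_interpNorm_add hν.le hx hs0 (by positivity) fun y => ?_
  calc kFunctional i s (i (v t)) ≤ ‖i (v t) - i y‖ + s * ‖y‖ := kFunctional_le hs0.le _ y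
    _ ≤ C * (‖x - i y‖ + t * ‖y‖ + t ^ ν * G) + s * ‖y‖ := by
        gcongr
        exact hbound t ht x g v hv G hG y
    _ ≤ C * (‖x - i y‖ + s * ‖y‖ + s ^ ν * G) + (‖x - i y‖ + s * ‖y‖ + s ^ ν * G) := by
        gcongr
        rw [add_assoc, add_left_comm]
        exact le_add_of_nonneg_right (by positivity)
    _ = (C + 1) * (‖x - i y‖ + s * ‖y‖ + s ^ ν * G) := by ring

/-- Regularity of the linear problem in the weighted space attached to `E_ν`, for every `ν`. -/
lemma exists_estimate (hi : Function.Injective i) (hμ : μ ∈ Ioo 0 1) (hT : 0 < T)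
    (h : MildSolvable i μ T B) (hν : ν ∈ Ioo 0 1) :
    ∃ C > 0, ∀ τ ∈ Ioc 0 T, ∀ x ∈ interpSpace i ν, ∀ g v, IsMild i μ τ B x g v →
      ∀ G, WeightedBound ν τ g G → WeightedBound ν τ v (C * (interpNorm i ν x + G)) ∧
        ∀ t ∈ Ioc 0 τ, interpNorm i ν (i (v t)) ≤ C * (interpNorm i ν x + G) := by
  obtain ⟨C, hC, hsmooth⟩ := h.exists_rpow_mul_norm_le hi hμ hT hν.1
  obtain ⟨C', hC', hK⟩ := h.exists_kFunctional_le hi hμ hT hν.1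
  refine ⟨C + C', by positivity, fun τ hτ x hx g v hv G hG => ?_⟩
  have hP : 0 ≤ interpNorm i ν x + G := add_nonneg (interpNorm_nonneg _) (hG.nonneg hτ.1)
  have hvb : WeightedBound ν τ v (C * (interpNorm i ν x + G)) := fun t ht =>
    hsmooth t ⟨ht.1, ht.2.trans hτ.2⟩ x hx g v (hv.mono ht.2) G (hG.mono ht.2)
  refine ⟨fun t ht => (hvb t ht).trans (by gcongr; linarith),
    fun t ht => interpNorm_le fun s hs => ?_⟩
  rcases le_total s t with hst | hts
  · calc kFunctional i s (i (v t)) ≤ s * ‖v t‖ := kFunctional_apply_le hs.le _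
      _ ≤ s ^ ν * (C * (interpNorm i ν x + G)) :=
          (hvb.const_of_le hν.2.le ht).mul_norm_le ⟨hs, hst⟩
      _ ≤ s ^ ν * ((C + C') * (interpNorm i ν x + G)) := by gcongr; linarith
  · calc kFunctional i s (i (v t)) ≤ s ^ ν * (C' * (interpNorm i ν x + G)) :=
          hK t ⟨ht.1, ht.2.trans hτ.2⟩ x hx g v (hv.mono ht.2) G (hG.mono ht.2) s hts
      _ ≤ s ^ ν * ((C + C') * (interpNorm i ν x + G)) := by gcongr; linarith

end MildSolvable

end LinearEstimates

/-! ### The remainder at an equilibrium -/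

section Remainder

variable {E₀ E₁ : Type*} [NormedAddCommGroup E₀] [NormedSpace ℝ E₀]
  [NormedAddCommGroup E₁] [NormedSpace ℝ E₁] {i : E₁ →L[ℝ] E₀} {μ β ν θ t r : ℝ} {w w₁ w₂ y : E₁}

/-- The size at time `t` of a function with values in `E₁`. Its supremum over `t` controls the norms
of both `BC_{1-μ}([0, T], E₁)` and `BC([0, T], E_μ)`. -/
noncomputable def weightedNorm (i : E₁ →L[ℝ] E₀) (μ t : ℝ) (w : E₁) : ℝ :=
  max (t ^ (1 - μ) * ‖w‖) (interpNorm i μ (i w))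

lemma interpNorm_le_weightedNorm (w : E₁) : interpNorm i μ (i w) ≤ weightedNorm i μ t w :=
  le_max_right _ _

lemma rpow_mul_norm_le_weightedNorm (w : E₁) : t ^ (1 - μ) * ‖w‖ ≤ weightedNorm i μ t w :=
  le_max_left _ _

lemma weightedNorm_nonneg (w : E₁) : 0 ≤ weightedNorm i μ t w :=
  (interpNorm_nonneg _).trans (interpNorm_le_weightedNorm w)

lemma weightedNorm_zero : weightedNorm i μ t 0 = 0 := by
  simp [weightedNorm, interpNorm_zero]

lemma interpNorm_apply_le_mul_weightedNorm (hμ : 0 ≤ μ) (hθ : θ ∈ Ico μ 1) (ht : 0 < t) (w : E₁) :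
    interpNorm i θ (i w) ≤ t ^ (μ - θ) * weightedNorm i μ t w := by
  refine (interpNorm_apply_le_max hμ hθ.1 hθ.2 ht w).trans (max_le ?_ ?_)
  · exact mul_le_mul_of_nonneg_left (interpNorm_le_weightedNorm w) (by positivity)
  · calc t ^ (1 - θ) * ‖w‖ = t ^ (μ - θ) * (t ^ (1 - μ) * ‖w‖) := by
          rw [← mul_assoc, ← Real.rpow_add ht]; ring_nf
      _ ≤ _ := mul_le_mul_of_nonneg_left (rpow_mul_norm_le_weightedNorm w) (by positivity)

/-- The right-hand side of `w' + A(y) w = remainder w`, the equation for the deviation `w = u - y`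
of a solution `u` from the equilibrium `y`. -/
noncomputable def remainder (i : E₁ →L[ℝ] E₀) (A : E₀ → E₁ →L[ℝ] E₀) (F₁ F₂ : E₀ → E₀) (y w : E₁) :
    E₀ :=
  F₁ (i (y + w)) + F₂ (i (y + w)) - A (i (y + w)) (y + w) + A (i y) w

variable {V : Set E₀} {A : E₀ → E₁ →L[ℝ] E₀} {F₁ F₂ : E₀ → E₀}

lemma IsEquilibrium.remainder_zero (hy : IsEquilibrium i V A F₁ F₂ y) :
    remainder i A F₁ F₂ y 0 = 0 := by
  simp [remainder, hy.2]

lemma norm_remainder_sub_le (w₁ w₂ : E₁) :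
    ‖remainder i A F₁ F₂ y w₁ - remainder i A F₁ F₂ y w₂‖ ≤
      ‖F₁ (i (y + w₁)) - F₁ (i (y + w₂))‖ + ‖F₂ (i (y + w₁)) - F₂ (i (y + w₂))‖ +
      ‖A (i (y + w₁)) - A (i y)‖ * ‖w₁ - w₂‖ +
      ‖A (i (y + w₁)) - A (i (y + w₂))‖ * (‖y‖ + ‖w₂‖) := by
  have hdec : remainder i A F₁ F₂ y w₁ - remainder i A F₁ F₂ y w₂ =
      (F₁ (i (y + w₁)) - F₁ (i (y + w₂))) + (F₂ (i (y + w₁)) - F₂ (i (y + w₂))) -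
      (A (i (y + w₁)) - A (i y)) (w₁ - w₂) - (A (i (y + w₁)) - A (i (y + w₂))) (y + w₂) := by
    simp only [remainder, sub_apply, map_add, map_sub]
    abel
  rw [hdec]
  grw [norm_sub_le, norm_sub_le, norm_add_le, ContinuousLinearMap.le_opNorm,
    ContinuousLinearMap.le_opNorm, norm_add_le y w₂]

lemma exists_lipschitz_near (hμ : μ < 1) (hV : IsOpenInInterp i μ V) (hH1 : HypH1 i μ V A F₁)
    (hy : i y ∈ V) :
    ∃ r₀ ∈ Ioc (0 : ℝ) 1, ∃ L ≥ 0, (∀ w, interpNorm i μ (i w) ≤ r₀ → i (y + w) ∈ V) ∧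
      ∀ w₁ w₂, interpNorm i μ (i w₁) ≤ r₀ → interpNorm i μ (i w₂) ≤ r₀ →
        ‖A (i (y + w₁)) - A (i (y + w₂))‖ ≤ L * interpNorm i μ (i (w₁ - w₂)) ∧
        ‖F₁ (i (y + w₁)) - F₁ (i (y + w₂))‖ ≤ L * interpNorm i μ (i (w₁ - w₂)) := by
  obtain ⟨rV, hrV, hopen⟩ := hV.2 _ hy
  obtain ⟨r₁, hr₁, L, hL⟩ := hH1.lipschitz _ hy
  obtain ⟨r₀, hr₀, hr⟩ := exists_between (lt_min one_pos (lt_min hrV hr₁))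
  obtain ⟨hr1, hrV, hr₁⟩ : r₀ < 1 ∧ r₀ < rV ∧ r₀ < r₁ := by simpa only [lt_min_iff] using hr
  have hsub (w : E₁) : i (y + w) - i y = i w := by rw [map_add, add_sub_cancel_left]
  have hmem (w : E₁) (hw : interpNorm i μ (i w) ≤ r₀) : i (y + w) ∈ V :=
    hopen _ (apply_mem_interpSpace hμ _) (by rw [hsub]; exact hw.trans_lt hrV)
  refine ⟨r₀, ⟨hr₀, hr1.le⟩, |L|, abs_nonneg L, hmem, fun w₁ w₂ hw₁ hw₂ => ?_⟩
  have h := hL _ (hmem w₁ hw₁) _ (hmem w₂ hw₂) (by rw [hsub]; exact hw₁.trans_lt hr₁)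
    (by rw [hsub]; exact hw₂.trans_lt hr₁)
  rw [← map_sub, add_sub_add_left_eq_sub] at h
  have hnonneg := interpNorm_nonneg (i := i) (θ := μ) (i (w₁ - w₂))
  grw [← le_abs_self L]
  exact h

lemma exists_remainder_sub_le (hμ : μ ∈ Ioo 0 1) (hV : IsOpenInInterp i μ V)
    (hH1 : HypH1 i μ V A F₁) (hH2 : HypH2 i μ V F₂ β) (hy : i y ∈ V) :
    ∃ r₀ ∈ Ioc (0 : ℝ) 1, ∃ L ≥ 0, ∃ C > 0, ∃ (m : ℕ) (b ρ : Fin m → ℝ),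
      (∀ j, b j ∈ Icc μ β ∧ 0 ≤ ρ j ∧ ρ j * (β - μ) + (b j - μ) ≤ 1 - μ) ∧
      ∀ w₁ w₂, interpNorm i μ (i w₁) ≤ r₀ → interpNorm i μ (i w₂) ≤ r₀ →
        ‖remainder i A F₁ F₂ y w₁ - remainder i A F₁ F₂ y w₂‖ ≤
          L * interpNorm i μ (i (w₁ - w₂)) * (1 + ‖y‖ + ‖w₂‖) +
          L * interpNorm i μ (i w₁) * ‖w₁ - w₂‖ +
          C * ∑ j, (1 + interpNorm i β (i (y + w₁)) ^ ρ j + interpNorm i β (i (y + w₂)) ^ ρ j) *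
            interpNorm i (b j) (i (w₁ - w₂)) := by
  obtain ⟨r₀, hr₀, L, hL, hmem, hlip⟩ := exists_lipschitz_near hμ.2 hV hH1 hy
  obtain ⟨hβ, m, b, ρ, hbρ, hF₂⟩ := hH2
  obtain ⟨C, hC, hF₂⟩ := hF₂ _ hy 1 one_pos
  refine ⟨r₀, hr₀, L, hL, C, hC, m, b, ρ, fun j => ⟨(hbρ j).1, (hbρ j).2.1, ?_⟩,
    fun w₁ w₂ hw₁ hw₂ => ?_⟩
  · exact (div_le_one (sub_pos.2 hμ.2)).1 (hbρ j).2.2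
  have hF := hF₂ _ ⟨hmem w₁ hw₁, apply_mem_interpSpace hβ.2 _⟩ _
    ⟨hmem w₂ hw₂, apply_mem_interpSpace hβ.2 _⟩
    (by rw [← map_sub, add_sub_cancel_left]; exact hw₁.trans hr₀.2)
    (by rw [← map_sub, add_sub_cancel_left]; exact hw₂.trans hr₀.2)
  rw [← map_sub i, add_sub_add_left_eq_sub] at hF
  have hA := (hlip w₁ 0 hw₁ (by simpa [interpNorm_zero] using hr₀.1.le)).1
  rw [add_zero, sub_zero] at hA
  obtain ⟨hA', hF₁⟩ := hlip w₁ w₂ hw₁ hw₂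
  refine (norm_remainder_sub_le w₁ w₂).trans ?_
  grw [hF, hF₁, hA, hA']
  linarith

/-- The criticality condition on `F₂` enters through this inequality of weights. -/
lemma rpow_mul_rpow_mul_rpow_le {a b ρ : ℝ} (ht : t ∈ Ioc 0 a) (ha : a ≤ 1) (hb : b ≤ β)
    (hcrit : ρ * (β - μ) + (b - μ) ≤ 1 - μ) :
    t ^ (1 - μ) * ((t / a) ^ (μ - β)) ^ ρ * t ^ (μ - b) ≤ a ^ (1 - β) := by
  have ha0 : 0 < a := ht.1.trans_le ht.2
  have ht0 := ht.1
  have hpow : t ^ (1 - b - ρ * (β - μ)) = t ^ (1 - μ) * t ^ ((μ - β) * ρ) * t ^ (μ - b) := by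
    rw [← Real.rpow_add ht0, ← Real.rpow_add ht0]
    ring_nf
  calc t ^ (1 - μ) * ((t / a) ^ (μ - β)) ^ ρ * t ^ (μ - b)
      = t ^ (1 - b - ρ * (β - μ)) / a ^ ((μ - β) * ρ) := by
        rw [← Real.rpow_mul (by positivity), Real.div_rpow ht0.le ha0.le, hpow]
        ring
    _ = a ^ (1 - b) * (t / a) ^ (1 - b - ρ * (β - μ)) := by
        rw [Real.div_rpow ht0.le ha0.le, mul_div_left_comm, ← Real.rpow_sub ha0, div_eq_mul_inv,
          ← Real.rpow_neg ha0.le]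
        ring_nf
    _ ≤ a ^ (1 - b) * 1 := by
        gcongr
        exact Real.rpow_le_one (by positivity) ((div_le_one ha0).2 ht.2) (by linarith)
    _ ≤ a ^ (1 - β) := by
        rw [mul_one]
        exact Real.rpow_le_rpow_of_exponent_ge ha0 ha (by linarith)

lemma interpNorm_apply_add_le {a : ℝ} (hμ : 0 ≤ μ) (hβ : β ∈ Ico μ 1) (ht : t ∈ Ioc 0 a)
    (ha : a ≤ 1) (hw : interpNorm i μ (i w) ≤ 1) (hwt : t ^ (1 - μ) * ‖w‖ ≤ a) :
    interpNorm i β (i (y + w)) ≤ (interpNorm i β (i y) + 1) * (t / a) ^ (μ - β) := by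
  have ha0 : 0 < a := ht.1.trans_le ht.2
  have hta : 0 < t / a := div_pos ht.1 ha0
  have hw1 : weightedNorm i μ (t / a) w ≤ 1 := by
    refine max_le ?_ hw
    calc (t / a) ^ (1 - μ) * ‖w‖ = t ^ (1 - μ) * ‖w‖ / a ^ (1 - μ) := by
          rw [Real.div_rpow ht.1.le ha0.le]; ring
      _ ≤ a / a ^ (1 - μ) := by gcongr
      _ = a ^ μ := by
          nth_rewrite 1 [← Real.rpow_one a]
          rw [← Real.rpow_sub ha0, sub_sub_cancel]
      _ ≤ 1 := Real.rpow_le_one ha0.le ha hμ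
  have hwβ : interpNorm i β (i w) ≤ (t / a) ^ (μ - β) :=
    (interpNorm_apply_le_mul_weightedNorm hμ hβ hta w).trans
      (mul_le_of_le_one_right (by positivity) hw1)
  have hone : 1 ≤ (t / a) ^ (μ - β) :=
    Real.one_le_rpow_of_pos_of_le_one_of_nonpos hta ((div_le_one ha0).2 ht.2) (sub_nonpos.2 hβ.1)
  have hadd := interpNorm_add_le (hμ.trans hβ.1) (apply_mem_interpSpace (i := i) hβ.2 y)
    (apply_mem_interpSpace (i := i) hβ.2 w)
  rw [← map_add] at hadd
  have hyβ := le_mul_of_one_le_right (interpNorm_nonneg (i := i) (θ := β) (i y)) hone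
  linarith

lemma one_add_rpow_add_rpow_le {c p q Q ρ : ℝ} (hρ : 0 ≤ ρ) (hc : 0 ≤ c) (hQ : 1 ≤ Q)
    (hp : p ∈ Icc 0 (c * Q)) (hq : q ∈ Icc 0 (c * Q)) :
    1 + p ^ ρ + q ^ ρ ≤ (1 + 2 * c ^ ρ) * Q ^ ρ := by
  have hp' := Real.rpow_le_rpow hp.1 hp.2 hρ
  have hq' := Real.rpow_le_rpow hq.1 hq.2 hρ
  rw [Real.mul_rpow hc (by linarith)] at hp' hq'
  linarith [Real.one_le_rpow hQ hρ]

/-- One summand of the structure condition (H2), measured in the time weight of `𝔼_{1,μ}`. -/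
lemma rpow_mul_critical_term_le {a b ρ : ℝ} (hμ : 0 ≤ μ) (hβ : β ∈ Ico μ 1) (hb : b ∈ Icc μ β)
    (hρ : 0 ≤ ρ) (hcrit : ρ * (β - μ) + (b - μ) ≤ 1 - μ) (ht : t ∈ Ioc 0 a) (ha : a ≤ 1)
    (hw₁ : interpNorm i μ (i w₁) ≤ 1) (hw₂ : interpNorm i μ (i w₂) ≤ 1)
    (hw₁t : t ^ (1 - μ) * ‖w₁‖ ≤ a) (hw₂t : t ^ (1 - μ) * ‖w₂‖ ≤ a) :
    t ^ (1 - μ) * ((1 + interpNorm i β (i (y + w₁)) ^ ρ + interpNorm i β (i (y + w₂)) ^ ρ) *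
        interpNorm i b (i (w₁ - w₂))) ≤
      (1 + 2 * (interpNorm i β (i y) + 1) ^ ρ) * (a ^ (1 - β) * weightedNorm i μ t (w₁ - w₂)) := by
  have ha0 : 0 < a := ht.1.trans_le ht.2
  have ht0 := ht.1
  have hc := interpNorm_nonneg (i := i) (θ := β) (i y)
  have hD := weightedNorm_nonneg (i := i) (μ := μ) (t := t) (w₁ - w₂)
  have hQ : 1 ≤ (t / a) ^ (μ - β) := Real.one_le_rpow_of_pos_of_le_one_of_nonpos
    (div_pos ht0 ha0) ((div_le_one ha0).2 ht.2) (sub_nonpos.2 hβ.1)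
  have hgrowth := one_add_rpow_add_rpow_le hρ (by positivity) hQ
    ⟨interpNorm_nonneg _, interpNorm_apply_add_le (y := y) hμ hβ ht ha hw₁ hw₁t⟩
    ⟨interpNorm_nonneg _, interpNorm_apply_add_le (y := y) hμ hβ ht ha hw₂ hw₂t⟩
  have hdiff := interpNorm_apply_le_mul_weightedNorm (i := i) hμ ⟨hb.1, hb.2.trans_lt hβ.2⟩ ht0
    (w₁ - w₂)
  have hweight := rpow_mul_rpow_mul_rpow_le ht ha hb.2 hcrit
  have hnonneg := interpNorm_nonneg (i := i) (θ := b) (i (w₁ - w₂))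
  calc _ ≤ t ^ (1 - μ) * ((1 + 2 * (interpNorm i β (i y) + 1) ^ ρ) * ((t / a) ^ (μ - β)) ^ ρ *
          (t ^ (μ - b) * weightedNorm i μ t (w₁ - w₂))) := by gcongr
    _ = (1 + 2 * (interpNorm i β (i y) + 1) ^ ρ) *
          (t ^ (1 - μ) * ((t / a) ^ (μ - β)) ^ ρ * t ^ (μ - b) *
            weightedNorm i μ t (w₁ - w₂)) := by ring
    _ ≤ _ := by gcongr

lemma rpow_mul_critical_sum_le {m : ℕ} {b ρ : Fin m → ℝ} {a : ℝ} (hμ : 0 ≤ μ) (hβ : β ∈ Ico μ 1)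
    (hbρ : ∀ j, b j ∈ Icc μ β ∧ 0 ≤ ρ j ∧ ρ j * (β - μ) + (b j - μ) ≤ 1 - μ) (ht : t ∈ Ioc 0 a)
    (ha : a ≤ 1) (hw₁ : interpNorm i μ (i w₁) ≤ 1) (hw₂ : interpNorm i μ (i w₂) ≤ 1)
    (hw₁t : t ^ (1 - μ) * ‖w₁‖ ≤ a) (hw₂t : t ^ (1 - μ) * ‖w₂‖ ≤ a) :
    t ^ (1 - μ) * ∑ j, (1 + interpNorm i β (i (y + w₁)) ^ ρ j +
        interpNorm i β (i (y + w₂)) ^ ρ j) * interpNorm i (b j) (i (w₁ - w₂)) ≤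
      (∑ j, (1 + 2 * (interpNorm i β (i y) + 1) ^ ρ j)) *
        (a ^ (1 - β) * weightedNorm i μ t (w₁ - w₂)) := by
  rw [Finset.mul_sum, Finset.sum_mul]
  exact Finset.sum_le_sum fun j _ => rpow_mul_critical_term_le hμ hβ (hbρ j).1 (hbρ j).2.1
    (hbρ j).2.2 ht ha hw₁ hw₂ hw₁t hw₂t

/-- In `E_μ` the remainder may be critical: its Lipschitz constant is small only because the
deviations are small in `E_μ` *and* in the time-weighted norm of `E₁`. -/
lemma exists_rpow_mul_norm_remainder_sub_le (hμ : μ ∈ Ioo 0 1) (hV : IsOpenInInterp i μ V)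
    (hH1 : HypH1 i μ V A F₁) (hH2 : HypH2 i μ V F₂ β) (hy : i y ∈ V) :
    ∃ K > 0, ∃ r₀ ∈ Ioc (0 : ℝ) 1, ∀ a ≤ 1, ∀ t ∈ Ioc 0 a, ∀ r ≤ r₀, ∀ w₁ w₂,
      interpNorm i μ (i w₁) ≤ r → interpNorm i μ (i w₂) ≤ r →
      t ^ (1 - μ) * ‖w₁‖ ≤ a → t ^ (1 - μ) * ‖w₂‖ ≤ a →
      t ^ (1 - μ) * ‖remainder i A F₁ F₂ y w₁ - remainder i A F₁ F₂ y w₂‖ ≤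
        K * (r * (t ^ (1 - μ) * ‖w₁ - w₂‖) + a ^ (1 - β) * weightedNorm i μ t (w₁ - w₂)) := by
  obtain ⟨r₀, hr₀, L, hL, C, hC, m, b, ρ, hbρ, hsub⟩ :=
    exists_remainder_sub_le hμ hV hH1 hH2 hy
  have hβ : β ∈ Ico μ 1 := ⟨hH2.1.1.le, hH2.1.2⟩
  have hc := interpNorm_nonneg (i := i) (θ := β) (i y)
  set S := ∑ j, (1 + 2 * (interpNorm i β (i y) + 1) ^ ρ j)
  have hS0 : 0 ≤ S := Finset.sum_nonneg fun j _ => by positivity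
  refine ⟨L * (2 + ‖y‖) + L + C * S + 1, by positivity, r₀, hr₀,
    fun a ha t ht r hr w₁ w₂ h₁ h₂ h₁t h₂t => ?_⟩
  have ht0 := ht.1
  have ha0 : 0 < a := ht0.trans_le ht.2
  have hr0 : 0 ≤ r := (interpNorm_nonneg _).trans h₁
  set d := ‖w₁ - w₂‖
  set D := weightedNorm i μ t (w₁ - w₂)
  have hD0 : 0 ≤ D := weightedNorm_nonneg _
  have hta : t ^ (1 - μ) ≤ a ^ (1 - β) :=
    (Real.rpow_le_rpow ht0.le ht.2 (sub_nonneg.2 hμ.2.le)).trans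
      (Real.rpow_le_rpow_of_exponent_ge ha0 ha (by linarith [hβ.1]))
  have hlin : t ^ (1 - μ) * (1 + ‖y‖ + ‖w₂‖) ≤ (2 + ‖y‖) * a ^ (1 - β) := by
    have : a ≤ a ^ (1 - β) := by
      simpa using Real.rpow_le_rpow_of_exponent_ge ha0 ha (by linarith [hβ.1, hμ.1] : 1 - β ≤ 1)
    have := mul_le_mul_of_nonneg_right hta (by positivity : 0 ≤ 1 + ‖y‖)
    linarith
  have hcrit := rpow_mul_critical_sum_le (y := y) hμ.1.le hβ hbρ ht ha
    (h₁.trans (hr.trans hr₀.2)) (h₂.trans (hr.trans hr₀.2)) h₁t h₂t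
  calc _ ≤ t ^ (1 - μ) * _ :=
        mul_le_mul_of_nonneg_left (hsub w₁ w₂ (h₁.trans hr) (h₂.trans hr)) (by positivity)
    _ = L * interpNorm i μ (i (w₁ - w₂)) * (t ^ (1 - μ) * (1 + ‖y‖ + ‖w₂‖)) +
          L * interpNorm i μ (i w₁) * (t ^ (1 - μ) * d) + C * (t ^ (1 - μ) * ∑ j, _) := by ring
    _ ≤ L * D * ((2 + ‖y‖) * a ^ (1 - β)) + L * r * (t ^ (1 - μ) * d) +
          C * (S * (a ^ (1 - β) * D)) := by
        have := interpNorm_le_weightedNorm (i := i) (μ := μ) (t := t) (w₁ - w₂)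
        gcongr
    _ ≤ _ := by
        have : 0 ≤ (L * (2 + ‖y‖) + C * S + 1) * (r * (t ^ (1 - μ) * d)) := by positivity
        have : 0 ≤ (L + 1) * (a ^ (1 - β) * D) := by positivity
        linarith

lemma subcritical_sum_le {m : ℕ} {b ρ : Fin m → ℝ} (hμ : 0 ≤ μ) (hβ : μ ≤ β) (hν : ν ∈ Ico β 1)
    (hbρ : ∀ j, b j ∈ Icc μ β ∧ 0 ≤ ρ j) (hw : interpNorm i ν (i w) ≤ 1) :
    ∑ j, (1 + interpNorm i β (i (y + w)) ^ ρ j + interpNorm i β (i y) ^ ρ j) *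
        interpNorm i (b j) (i w) ≤
      (∑ j, (1 + 2 * (interpNorm i β (i y) + max 1 ‖i‖) ^ ρ j)) *
        (max 1 ‖i‖ * interpNorm i ν (i w)) := by
  have he0 : 0 ≤ max 1 ‖i‖ := zero_le_one.trans (le_max_left _ _)
  have hemb (θ : ℝ) (hθ : θ ∈ Icc μ ν) : interpNorm i θ (i w) ≤ max 1 ‖i‖ * interpNorm i ν (i w) :=
    interpNorm_le_mul_interpNorm (hμ.trans hθ.1) hθ.2 (apply_mem_interpSpace hν.2 w)
  have hy := interpNorm_nonneg (i := i) (θ := β) (i y)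
  have hyw : interpNorm i β (i (y + w)) ≤ interpNorm i β (i y) + max 1 ‖i‖ := by
    rw [map_add]
    grw [interpNorm_add_le (hμ.trans hβ) (apply_mem_interpSpace (hν.1.trans_lt hν.2) y)
      (apply_mem_interpSpace (hν.1.trans_lt hν.2) w), hemb β ⟨hβ, hν.1⟩, hw, mul_one]
  rw [Finset.sum_mul]
  refine Finset.sum_le_sum fun j _ => mul_le_mul ?_
    (hemb (b j) ⟨(hbρ j).1.1, (hbρ j).1.2.trans hν.1⟩) (interpNorm_nonneg _) (by positivity)
  have hgrowth := one_add_rpow_add_rpow_le (hbρ j).2 (add_nonneg hy he0) le_rfl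
    ⟨interpNorm_nonneg (i := i) (θ := β) (i (y + w)), by rwa [mul_one]⟩
    ⟨hy, by rw [mul_one]; linarith⟩
  rwa [Real.one_rpow, mul_one] at hgrowth

/-- In the spaces `E_ν` with `ν ≥ β` the remainder is subcritical: the weight `t ^ (1 - ν)` alone
makes it small. -/
lemma exists_rpow_mul_norm_remainder_le (hμ : μ ∈ Ioo 0 1) (hV : IsOpenInInterp i μ V)
    (hH1 : HypH1 i μ V A F₁) (hH2 : HypH2 i μ V F₂ β) (hy : IsEquilibrium i V A F₁ F₂ y)
    (hν : ν ∈ Ico β 1) :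
    ∃ K > 0, ∃ r₀ ∈ Ioc (0 : ℝ) 1, ∀ t > 0, ∀ r ≤ r₀, ∀ w,
      interpNorm i μ (i w) ≤ r → interpNorm i ν (i w) ≤ 1 →
      t ^ (1 - ν) * ‖remainder i A F₁ F₂ y w‖ ≤
        K * (r + t ^ (1 - ν)) * weightedNorm i ν t w := by
  obtain ⟨r₀, hr₀, L, hL, C, hC, m, b, ρ, hbρ, hsub⟩ :=
    exists_remainder_sub_le hμ hV hH1 hH2 hy.1
  have hβ := hH2.1
  have hc := interpNorm_nonneg (i := i) (θ := β) (i y)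
  set e := max 1 ‖i‖
  set S := ∑ j, (1 + 2 * (interpNorm i β (i y) + e) ^ ρ j)
  have he0 : 0 ≤ e := zero_le_one.trans (le_max_left _ _)
  have hS0 : 0 ≤ S := Finset.sum_nonneg fun j _ => by positivity
  refine ⟨L * e * (1 + ‖y‖) + L + C * (S * e) + 1, by positivity, r₀, hr₀,
    fun t ht r hr w hwr hw1 => ?_⟩
  have hr0 : 0 ≤ r := (interpNorm_nonneg _).trans hwr
  set D := weightedNorm i ν t w
  have hD0 : 0 ≤ D := weightedNorm_nonneg _
  have hDν : interpNorm i ν (i w) ≤ D := interpNorm_le_weightedNorm w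
  have hDμ : interpNorm i μ (i w) ≤ e * D := by
    grw [interpNorm_le_mul_interpNorm hμ.1.le (hβ.1.le.trans hν.1)
      (apply_mem_interpSpace hν.2 w), hDν]
  have hsum := (subcritical_sum_le (y := y) hμ.1.le hβ.1.le hν (fun j => ⟨(hbρ j).1, (hbρ j).2.1⟩)
    hw1).trans (mul_le_mul_of_nonneg_left (mul_le_mul_of_nonneg_left hDν he0) hS0)
  have hrem := hsub w 0 (hwr.trans hr) (by simpa [interpNorm_zero] using hr₀.1.le)
  rw [hy.remainder_zero, sub_zero, sub_zero, add_zero, norm_zero, add_zero] at hrem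
  calc _ ≤ t ^ (1 - ν) * _ := mul_le_mul_of_nonneg_left hrem (by positivity)
    _ = t ^ (1 - ν) * (L * interpNorm i μ (i w) * (1 + ‖y‖)) +
          L * interpNorm i μ (i w) * (t ^ (1 - ν) * ‖w‖) + t ^ (1 - ν) * (C * ∑ j, _) := by ring
    _ ≤ t ^ (1 - ν) * (L * (e * D) * (1 + ‖y‖)) + L * r * D +
          t ^ (1 - ν) * (C * (S * (e * D))) := by
        have := rpow_mul_norm_le_weightedNorm (i := i) (μ := ν) (t := t) w
        gcongr
    _ ≤ _ := by
        have : 0 ≤ (L * e * (1 + ‖y‖) + C * (S * e) + 1) * (r * D) := by positivity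
        have : 0 ≤ (L + 1) * (t ^ (1 - ν) * D) := by positivity
        linarith

end Remainder

/-! ### Semilinear problems with a contractive right-hand side -/

lemma le_of_bootstrap {c : ℝ → ℝ} {τ r : ℝ} (hc : ContinuousOn c (Ioc 0 τ))
    (h0 : ∀ᶠ t in 𝓝[>] 0, c t ≤ r)
    (hstep : ∀ t ∈ Ioc 0 τ, (∀ s ∈ Ioc 0 t, c s ≤ r) → c t < r) : ∀ t ∈ Ioc 0 τ, c t ≤ r := by
  by_contra! ⟨t₁, ht₁, hct₁⟩
  obtain ⟨a, ha, hca⟩ := mem_nhdsGT_iff_exists_Ioc_subset.1 h0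
  have hat₁ : a < t₁ := lt_of_not_ge fun h => (hca ⟨ht₁.1, h⟩).not_gt hct₁
  have hcont : ContinuousOn c (Icc a t₁) := hc.mono (Icc_subset_Ioc ha ht₁.2)
  have hclosed := hcont.preimage_isClosed_of_isClosed isClosed_Icc (isClosed_Ici (a := r))
  obtain ⟨s, ⟨hs, hrs⟩, hleast⟩ := (isCompact_Icc.of_isClosed_subset hclosed
    inter_subset_left).exists_isLeast ⟨t₁, right_mem_Icc.2 hat₁.le, hct₁.le⟩
  have hlt : ∀ s' ∈ Ioo 0 s, c s' ≤ r := fun s' hs' => by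
    rcases le_or_gt s' a with h | h
    · exact hca ⟨hs'.1, h⟩
    · exact le_of_not_ge fun h' => hs'.2.not_ge (hleast ⟨⟨h.le, hs'.2.le.trans hs.2⟩, h'⟩)
  have hs0 : 0 < s := lt_of_lt_of_le ha hs.1
  have hsr : c s ≤ r := by
    have hcs : ContinuousWithinAt c (Ioo 0 s) s :=
      (hc s ⟨hs0, hs.2.trans ht₁.2⟩).mono fun s' hs' =>
        ⟨hs'.1, hs'.2.le.trans (hs.2.trans ht₁.2)⟩
    exact hcs.closure_le (by simp [closure_Ioo hs0.ne, hs0.le]) continuousWithinAt_const hlt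
  refine (hstep s ⟨hs0, hs.2.trans ht₁.2⟩ fun s' hs' => ?_).not_ge hrs
  rcases hs'.2.eq_or_lt with rfl | h
  exacts [hsr, hlt s' ⟨hs'.1, h⟩]

lemma mul_add_div_four_mul_lt {C R a : ℝ} (hC : 0 < C) (hR : 0 < R) (h : 4 * C * a ≤ R) :
    C * (a + R / (4 * C)) < R := by
  calc C * (a + R / (4 * C)) = (4 * C * a + R) / 4 := by field_simp
    _ < R := by linarith

section Contractive

variable {E₀ E₁ : Type*} [NormedAddCommGroup E₀] [NormedSpace ℝ E₀]
  [NormedAddCommGroup E₁] [NormedSpace ℝ E₁] {i B : E₁ →L[ℝ] E₀} {μ ν t τ C ε R G : ℝ}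
  {N : E₁ → E₀} {x : E₀} {g g₁ g₂ : ℝ → E₀} {w w₁ w₂ : ℝ → E₁}

lemma continuous_interpNorm_apply (hμ : μ ∈ Ico 0 1) :
    Continuous fun w : E₁ => interpNorm i μ (i w) := by
  refine (LipschitzWith.of_le_add_mul (max 1 ‖i‖).toNNReal fun w w' => ?_).continuous
  calc interpNorm i μ (i w) = interpNorm i μ (i w' + i (w - w')) := by
        rw [← map_add, add_sub_cancel]
    _ ≤ interpNorm i μ (i w') + interpNorm i μ (i (w - w')) := interpNorm_add_le hμ.1
        (apply_mem_interpSpace hμ.2 _) (apply_mem_interpSpace hμ.2 _)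
    _ ≤ _ := by
        rw [dist_eq_norm, Real.coe_toNNReal _ (by positivity)]
        gcongr
        exact interpNorm_apply_le ⟨hμ.1, hμ.2.le⟩ _

lemma continuousOn_weightedNorm (hμ : μ ∈ Ico 0 1) (hw : ContinuousOn w (Ioc 0 τ)) :
    ContinuousOn (fun t => weightedNorm i μ t (w t)) (Ioc 0 τ) :=
  (((continuousOn_rpow_Ioi _).mono Ioc_subset_Ioi_self).mul hw.norm).sup
    ((continuous_interpNorm_apply hμ).comp_continuousOn hw)

lemma continuous_weightedNorm (hμ : μ ∈ Ico 0 1) (t : ℝ) :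
    Continuous fun w : E₁ => weightedNorm i μ t w :=
  (continuous_const.mul continuous_norm).sup (continuous_interpNorm_apply hμ)

lemma weightedNorm_mono (hμ : μ ≤ 1) {s : ℝ} (hs : 0 ≤ s) (hst : s ≤ t) (w : E₁) :
    weightedNorm i μ s w ≤ weightedNorm i μ t w :=
  max_le_max_right _ <| by gcongr

/-- The estimate of solutions of `v' + B v = g`, `v(0) = x`, on short intervals, by the norms of `x`
in `E_ν` and of `g` in `BC_{1-ν}`. -/
def LinearEstimate (i : E₁ →L[ℝ] E₀) (μ : ℝ) (B : E₁ →L[ℝ] E₀) (ν C ε : ℝ) : Prop :=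
  ∀ τ ∈ Ioc 0 ε, ∀ x ∈ interpSpace i ν, ∀ g v, IsMild i μ τ B x g v → ∀ G, WeightedBound ν τ g G →
    ∀ t ∈ Ioc 0 τ, weightedNorm i ν t (v t) ≤ C * (interpNorm i ν x + G)

lemma LinearEstimate.weightedNorm_lt (h : LinearEstimate i μ B ν C ε) (hC : 0 < C)
    (hτ : τ ∈ Ioc 0 ε) (hR : 0 < R) (hx : x ∈ interpSpace i ν) (hxR : 4 * C * interpNorm i ν x ≤ R)
    (hw : IsMild i μ τ B x g w) (hg : WeightedBound ν τ g (R / (4 * C))) (ht : t ∈ Ioc 0 τ) :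
    weightedNorm i ν t (w t) < R :=
  (h τ hτ x hx g w hw _ hg t ht).trans_lt (mul_add_div_four_mul_lt hC hR hxR)

/-- The setting in which `w' + B w = N(w)` is solved on `(0, ε]` by the contraction principle: the
linear problem is solvable with a solution operator of norm at most `C`, and `N` has Lipschitz
constant `1 / (4 C)` on the ball of radius `ε`. -/
structure IsContractive (i : E₁ →L[ℝ] E₀) (μ : ℝ) (B : E₁ →L[ℝ] E₀) (C ε : ℝ) (N : E₁ → E₀) :
    Prop where
  C_pos : 0 < C
  ε_pos : 0 < ε
  exists_sol : ∀ x ∈ interpSpace i μ, ∀ g, IsBC μ ε g → ∃ v, IsMild i μ ε B x g v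
  linear : LinearEstimate i μ B μ C ε
  zero : N 0 = 0
  lipschitz : ∀ t ∈ Ioc 0 ε, ∀ w₁ w₂, weightedNorm i μ t w₁ ≤ ε → weightedNorm i μ t w₂ ≤ ε →
    t ^ (1 - μ) * ‖N w₁ - N w₂‖ ≤ weightedNorm i μ t (w₁ - w₂) / (4 * C)
  vanishing : ∀ w : ℝ → E₁, IsBC μ ε w → (∀ t ∈ Ioc 0 ε, weightedNorm i μ t (w t) ≤ ε) →
    Tendsto (fun t => ‖t ^ (1 - μ) • N (w t)‖) (𝓝[>] 0) (𝓝 0)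

/-- The additional estimates under which solutions of `w' + B w = N(w)` starting near `0` in `E_ν`
stay near `0` in `E_ν`. -/
structure IsSubcritical (i : E₁ →L[ℝ] E₀) (μ ν : ℝ) (B : E₁ →L[ℝ] E₀) (C ε : ℝ) (N : E₁ → E₀) :
    Prop where
  linear : LinearEstimate i μ B ν C ε
  rpow_mul_norm_le : ∀ t ∈ Ioc 0 ε, ∀ w, weightedNorm i μ t w ≤ ε → weightedNorm i ν t w ≤ ε →
    t ^ (1 - ν) * ‖N w‖ ≤ weightedNorm i ν t w / (4 * C)

namespace IsContractive

lemma isSubcritical (h : IsContractive i μ B C ε N) : IsSubcritical i μ μ B C ε N where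
  linear := h.linear
  rpow_mul_norm_le t ht w hw _ := by
    simpa [h.zero] using h.lipschitz t ht w 0 hw (by simpa [weightedNorm_zero] using h.ε_pos.le)

lemma continuousOn (hμ : μ ∈ Ico 0 1) (h : IsContractive i μ B C ε N) (ht : t ∈ Ioc 0 ε) :
    ContinuousOn N {w | weightedNorm i μ t w ≤ ε} := fun w₀ hw₀ => by
  have hweight : 0 < t ^ (1 - μ) := Real.rpow_pos_of_pos ht.1 _
  have hlim : Tendsto (fun w => weightedNorm i μ t (w - w₀) / (4 * C) / t ^ (1 - μ))
      (𝓝[{w | weightedNorm i μ t w ≤ ε}] w₀) (𝓝 0) := by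
    have := (((continuous_weightedNorm (i := i) hμ t).comp (continuous_sub_right w₀)).tendsto
      w₀).mono_left (nhdsWithin_le_nhds (s := {w | weightedNorm i μ t w ≤ ε}))
    simpa [weightedNorm_zero] using (this.div_const (4 * C)).div_const (t ^ (1 - μ))
  rw [ContinuousWithinAt, tendsto_iff_norm_sub_tendsto_zero]
  refine squeeze_zero' (.of_forall fun _ => norm_nonneg _) ?_ hlim
  filter_upwards [self_mem_nhdsWithin] with w hw
  rw [le_div_iff₀' hweight]
  exact h.lipschitz t ht w w₀ hw hw₀

lemma isBC_comp (hμ : μ ∈ Ico 0 1) (h : IsContractive i μ B C ε N) (hw : IsBC μ ε w)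
    (hwε : ∀ t ∈ Ioc 0 ε, weightedNorm i μ t (w t) ≤ ε) : IsBC μ ε (N ∘ w) where
  continuousOn t₀ ht₀ := by
    have hhalf : t₀ / 2 ∈ Ioc 0 ε := ⟨half_pos ht₀.1, (half_le_self ht₀.1.le).trans ht₀.2⟩
    have hball (s) (hs : s ∈ Ioc 0 ε) (hs' : t₀ / 2 ≤ s) : weightedNorm i μ (t₀ / 2) (w s) ≤ ε :=
      (weightedNorm_mono hμ.2.le hhalf.1.le hs' _).trans (hwε s hs)
    have hN := h.continuousOn hμ hhalf (w t₀) (hball t₀ ht₀ (half_le_self ht₀.1.le))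
    refine hN.tendsto.comp (tendsto_nhdsWithin_iff.2 ⟨hw.continuousOn t₀ ht₀, ?_⟩)
    filter_upwards [self_mem_nhdsWithin, mem_nhdsWithin_of_mem_nhds
      (Ioi_mem_nhds (half_lt_self ht₀.1))] with s hs hs' using hball s hs (le_of_lt hs')
  bounded := by
    have hC := h.C_pos
    refine ⟨ε / (4 * C), fun t ht => ?_⟩
    rw [norm_rpow_smul ht.1.le]
    exact (h.isSubcritical.rpow_mul_norm_le t ht _ (hwε t ht) (hwε t ht)).trans
      (by gcongr; exact hwε t ht)
  vanishing := h.vanishing w hw hwε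

lemma weightedNorm_le (hμ : μ ∈ Ico 0 1) (h : IsContractive i μ B C ε N) (hτ : τ ∈ Ioc 0 ε)
    (hx : x ∈ interpSpace i μ) (hw : IsMild i μ τ B x (N ∘ w) w) (hR : R ∈ Ioc 0 ε)
    (hxR : 4 * C * interpNorm i μ x ≤ R) : ∀ t ∈ Ioc 0 τ, weightedNorm i μ t (w t) ≤ R := by
  have hC := h.C_pos
  have hR0 := hR.1
  have hlt (t) (ht : t ∈ Ioc 0 τ) (hg : WeightedBound μ t (N ∘ w) (R / (4 * C))) :
      weightedNorm i μ t (w t) < R :=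
    h.linear.weightedNorm_lt hC ⟨ht.1, ht.2.trans hτ.2⟩ hR0 hx hxR (hw.mono ht.2) hg ⟨ht.1, le_rfl⟩
  refine le_of_bootstrap (continuousOn_weightedNorm hμ hw.bc.continuousOn) ?_
    fun t ht hle => hlt t ht fun s hs => ?_
  · have hsmall := hw.bc_rhs.vanishing.eventually_le_const
      (show 0 < R / (4 * C) by positivity)
    obtain ⟨a, ha, hsub⟩ := mem_nhdsGT_iff_exists_Ioc_subset.1 hsmall
    filter_upwards [Ioc_mem_nhdsGT ha, Ioc_mem_nhdsGT hτ.1] with t hta htτ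
    refine (hlt t htτ fun s hs => ?_).le
    rw [← norm_rpow_smul hs.1.le]
    exact hsub ⟨hs.1, hs.2.trans hta.2⟩
  · have hs' : s ∈ Ioc 0 ε := ⟨hs.1, hs.2.trans (ht.2.trans hτ.2)⟩
    have hsε := (hle s hs).trans hR.2
    exact (h.isSubcritical.rpow_mul_norm_le s hs' _ hsε hsε).trans (by gcongr; exact hle s hs)

lemma weightedBound_comp_sub (hμ : μ ∈ Ioo 0 1) (h : IsContractive i μ B C ε N) (hτ : τ ∈ Ioc 0 ε)
    (hw₁ : IsMild i μ τ B x g₁ w₁) (hw₂ : IsMild i μ τ B x g₂ w₂)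
    (hε₁ : ∀ t ∈ Ioc 0 τ, weightedNorm i μ t (w₁ t) ≤ ε)
    (hε₂ : ∀ t ∈ Ioc 0 τ, weightedNorm i μ t (w₂ t) ≤ ε)
    (hG : WeightedBound μ τ (fun t => g₁ t - g₂ t) G) :
    WeightedBound μ τ (fun t => N (w₁ t) - N (w₂ t)) (G / 4) := fun t ht => by
  have hC := h.C_pos
  have hsub := hw₁.sub hμ hτ.1 hw₂
  rw [sub_self] at hsub
  calc t ^ (1 - μ) * ‖N (w₁ t) - N (w₂ t)‖ ≤ weightedNorm i μ t (w₁ t - w₂ t) / (4 * C) :=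
        h.lipschitz t ⟨ht.1, ht.2.trans hτ.2⟩ _ _ (hε₁ t ht) (hε₂ t ht)
    _ ≤ C * (interpNorm i μ (0 : E₀) + G) / (4 * C) := by
        gcongr
        exact h.linear τ hτ 0 (zero_mem_interpSpace hμ.2) _ _ hsub G hG t ht
    _ = G / 4 := by rw [interpNorm_zero, zero_add]; field_simp

lemma eqOn (hμ : μ ∈ Ioo 0 1) (h : IsContractive i μ B C ε N) (hτ : τ ∈ Ioc 0 ε)
    (hx : x ∈ interpSpace i μ) (hxε : 4 * C * interpNorm i μ x ≤ ε)
    (hw₁ : IsMild i μ τ B x (N ∘ w₁) w₁) (hw₂ : IsMild i μ τ B x (N ∘ w₂) w₂) :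
    EqOn w₁ w₂ (Ioc 0 τ) := fun t ht => by
  have hbound {w : ℝ → E₁} (hw : IsMild i μ τ B x (N ∘ w) w) :=
    h.weightedNorm_le ⟨hμ.1.le, hμ.2⟩ hτ hx hw ⟨h.ε_pos, le_rfl⟩ hxε
  obtain ⟨γ, hγ⟩ := (hw₁.bc_rhs.sub hμ.2 hτ.1 hw₂.bc_rhs).exists_unweight (hT := hτ.1.le) hμ.2 hτ.1
  have himprove := h.weightedBound_comp_sub hμ hτ hw₁ hw₂ (hbound hw₁) (hbound hw₂)
    ((weightedBound_unweight γ).congr hγ.symm)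
  have hγ0 : ‖γ‖ = 0 := le_antisymm
    (by linarith [norm_le_of_weightedBound_unweight hτ.1 (himprove.congr hγ)]) (norm_nonneg _)
  have hsub := hw₁.sub hμ hτ.1 hw₂
  rw [sub_self] at hsub
  have hzero := h.linear τ hτ 0 (zero_mem_interpSpace hμ.2) _ _ hsub _
    ((weightedBound_unweight γ).congr hγ.symm) t ht
  rw [hγ0, interpNorm_zero, add_zero, mul_zero] at hzero
  have hnorm := nonpos_of_mul_nonpos_right ((rpow_mul_norm_le_weightedNorm _).trans hzero)
    (Real.rpow_pos_of_pos ht.1 _)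
  exact sub_eq_zero.1 (norm_le_zero_iff.1 hnorm)

end IsContractive

variable {hε : 0 ≤ ε} {a : ℝ}

/-- The right-hand sides on which the iteration acts, as a subset of `BC_{1-μ}([0, ε], E₀)`. -/
def smallRhs (E₀ : Type*) [NormedAddCommGroup E₀] [NormedSpace ℝ E₀] (hε : 0 ≤ ε) (μ ν a R : ℝ) :
    Set (VanishingAtZero E₀ hε) :=
  {γ | WeightedBound μ ε (unweight μ γ) a ∧ WeightedBound ν ε (unweight μ γ) R}

lemma isClosed_smallRhs : IsClosed (smallRhs E₀ hε μ ν a R) := by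
  have hclosed (θ M : ℝ) :
      IsClosed {γ : VanishingAtZero E₀ hε | WeightedBound θ ε (unweight μ γ) M} := by
    simp only [WeightedBound, Set.ofPred_forall]
    exact isClosed_biInter fun t _ =>
      isClosed_le (continuous_const.mul (continuous_unweight_apply t).norm) continuous_const
  exact (hclosed μ a).inter (hclosed ν R)

lemma zero_mem_smallRhs (ha : 0 ≤ a) (hR : 0 ≤ R) : 0 ∈ smallRhs E₀ hε μ ν a R := by
  constructor <;> intro t _ <;> simpa [unweight]

namespace IsContractive

lemma exists_iterate (hμ : μ ∈ Ico 0 1) (h : IsContractive i μ B C ε N)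
    (hν : IsSubcritical i μ ν B C ε N) (hx : x ∈ interpSpace i μ)
    (hxε : 4 * C * interpNorm i μ x ≤ ε) (hxν : x ∈ interpSpace i ν) (hR : R ∈ Ioc 0 ε)
    (hxR : 4 * C * interpNorm i ν x ≤ R)
    (γ : smallRhs E₀ h.ε_pos.le μ ν (ε / (4 * C)) (R / (4 * C))) :
    ∃ γ' : smallRhs E₀ h.ε_pos.le μ ν (ε / (4 * C)) (R / (4 * C)), ∃ w,
      IsMild i μ ε B x (unweight μ γ.1) w ∧ EqOn (unweight μ γ'.1) (N ∘ w) (Ioc 0 ε) ∧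
      ∀ t ∈ Ioc 0 ε, weightedNorm i μ t (w t) ≤ ε ∧ weightedNorm i ν t (w t) ≤ R := by
  have hC := h.C_pos
  have hε : ε ∈ Ioc 0 ε := ⟨h.ε_pos, le_rfl⟩
  obtain ⟨w, hw⟩ := h.exists_sol x hx _ (isBC_unweight hμ.2 h.ε_pos γ.1)
  have hwμ (t) (ht : t ∈ Ioc 0 ε) : weightedNorm i μ t (w t) ≤ ε :=
    (h.linear.weightedNorm_lt hC hε h.ε_pos hx hxε hw γ.2.1 ht).le
  have hwν (t) (ht : t ∈ Ioc 0 ε) : weightedNorm i ν t (w t) ≤ R :=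
    (hν.linear.weightedNorm_lt hC hε hR.1 hxν hxR hw γ.2.2 ht).le
  obtain ⟨γ', hγ'⟩ := (h.isBC_comp hμ hw.bc hwμ).exists_unweight (hT := h.ε_pos.le) hμ.2 h.ε_pos
  have hγ'μ : WeightedBound μ ε (N ∘ w) (ε / (4 * C)) := fun t ht =>
    (h.isSubcritical.rpow_mul_norm_le t ht _ (hwμ t ht) (hwμ t ht)).trans
      (by gcongr; exact hwμ t ht)
  have hγ'ν : WeightedBound ν ε (N ∘ w) (R / (4 * C)) := fun t ht =>
    (hν.rpow_mul_norm_le t ht _ (hwμ t ht) ((hwν t ht).trans hR.2)).trans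
      (by gcongr; exact hwν t ht)
  exact ⟨⟨γ', hγ'μ.congr hγ', hγ'ν.congr hγ'⟩, w, hw, hγ', fun t ht => ⟨hwμ t ht, hwν t ht⟩⟩

lemma exists_solution [CompleteSpace E₀] (hμ : μ ∈ Ioo 0 1) (h : IsContractive i μ B C ε N)
    (hν : IsSubcritical i μ ν B C ε N) (hx : x ∈ interpSpace i μ)
    (hxε : 4 * C * interpNorm i μ x ≤ ε) (hxν : x ∈ interpSpace i ν) (hR : R ∈ Ioc 0 ε)
    (hxR : 4 * C * interpNorm i ν x ≤ R) :
    ∃ w, IsMild i μ ε B x (N ∘ w) w ∧ ∀ t ∈ Ioc 0 ε, weightedNorm i ν t (w t) ≤ R := by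
  have hC := h.C_pos
  have hε := h.ε_pos
  have hR0 := hR.1
  choose Ψ w hw hΨ hwR using h.exists_iterate ⟨hμ.1.le, hμ.2⟩ hν hx hxε hxν hR hxR
  have : CompleteSpace (smallRhs E₀ hε.le μ ν (ε / (4 * C)) (R / (4 * C))) :=
    isClosed_smallRhs.completeSpace_coe
  have : Nonempty (smallRhs E₀ hε.le μ ν (ε / (4 * C)) (R / (4 * C))) :=
    ⟨⟨0, zero_mem_smallRhs (by positivity) (by positivity)⟩⟩
  have hcontr : ContractingWith (1 / 4) Ψ := by
    refine ⟨by rw [← NNReal.coe_lt_coe]; norm_num, LipschitzWith.of_dist_le_mul fun γ₁ γ₂ => ?_⟩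
    simp only [Subtype.dist_eq γ₁, Subtype.dist_eq (Ψ γ₁), dist_eq_norm]
    have himprove := h.weightedBound_comp_sub hμ ⟨hε, le_rfl⟩ (hw γ₁) (hw γ₂)
      (fun t ht => (hwR γ₁ t ht).1) (fun t ht => (hwR γ₂ t ht).1)
      ((weightedBound_unweight (γ₁.1 - γ₂.1)).congr fun t _ => (unweight_sub _ _ t).symm)
    refine norm_le_of_weightedBound_unweight (μ := μ) hε (fun t ht => ?_)
    rw [unweight_sub, hΨ γ₁ ht, hΨ γ₂ ht, show ((1 / 4 : NNReal) : ℝ) = 1 / 4 by norm_num,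
      one_div_mul_eq_div]
    exact himprove t ht
  let γ := hcontr.fixedPoint
  have hfix : EqOn (unweight μ γ.1) (N ∘ w γ) (Ioc 0 ε) := by
    have hγ := hΨ γ
    rwa [hcontr.fixedPoint_isFixedPt] at hγ
  exact ⟨w γ, (hw γ).congr hε hfix.symm fun _ _ => rfl, fun t ht => (hwR γ t ht).2⟩

end IsContractive

end Contractive

/-! ### Solutions near an equilibrium -/

section Solutions

lemma IsBC.tendsto_add_left {E : Type*} [NormedAddCommGroup E] [NormedSpace ℝ E] {μ a b : ℝ}
    {f : ℝ → E} (hf : IsBC μ b f) (ha : a ∈ Ioo 0 b) :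
    Tendsto (fun s => f (a + s)) (𝓝[>] 0) (𝓝 (f a)) := by
  have hadd : Tendsto (fun s => a + s) (𝓝 0) (𝓝 a) := by
    simpa only [add_zero, id_eq] using (tendsto_id (x := 𝓝 (0 : ℝ))).const_add a
  exact (hf.continuousOn.continuousAt (Ioc_mem_nhds ha.1 ha.2)).tendsto.comp
    (hadd.mono_left nhdsWithin_le_nhds)

variable {E₀ E₁ : Type*} [NormedAddCommGroup E₀] [NormedSpace ℝ E₀] [CompleteSpace E₀]
  [NormedAddCommGroup E₁] [NormedSpace ℝ E₁] {i : E₁ →L[ℝ] E₀} {μ ν C ε T a R t : ℝ} {V : Set E₀}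
  {A : E₀ → E₁ →L[ℝ] E₀} {F₁ F₂ : E₀ → E₀} {y : E₁} {x : E₀} {u u' : ℝ → E₀}

lemma isSolution_iff (hμ : μ ∈ Ioo 0 1) (hT : 0 < T) (y : E₁) :
    IsSolution i μ V A F₁ F₂ T x u ↔ u 0 = x ∧ (∀ t ∈ Icc 0 T, u t ∈ V) ∧
      ∃ w, (∀ t ∈ Ioc 0 T, u t = i (y + w t)) ∧
        IsMild i μ T (A (i y)) (x - i y) (remainder i A F₁ F₂ y ∘ w) w := by
  have hconst := IsMild.const (i := i) (B := A (i y)) hμ.2 hT y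
  constructor
  · rintro ⟨v, u', hu, hx, hV, heq⟩
    have hm := (hu.isMild (B := A (i y)) hμ hT).sub hμ hT hconst
    rw [hx] at hm
    refine ⟨hx, hV, fun t => v t - y, fun t ht => by rw [add_sub_cancel, hu.lift t ht],
      hm.congr hT (fun t ht => ?_) fun _ _ => rfl⟩
    have heq_t := heq t ht
    rw [← hu.lift t ht] at heq_t
    simp only [Function.comp_apply, remainder, add_sub_cancel, map_sub (A (i y)), ← heq_t]
    abel
  · rintro ⟨hx, hV, w, hw, hm⟩
    have hsum := hconst.add hμ hT hm
    rw [add_sub_cancel] at hsum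
    refine ⟨_, _, hsum.isMaxRegFun hμ hT hx hw, hx, hV, fun t ht => ?_⟩
    rw [hw t ht]
    simp only [Function.comp_apply, remainder, map_add (A (i y))]
    abel

namespace IsSolution

lemma mono (hμ : μ ∈ Ioo 0 1) (h : IsSolution i μ V A F₁ F₂ T x u) (ha : a ∈ Ioc 0 T) :
    IsSolution i μ V A F₁ F₂ a x u := by
  obtain ⟨hx, hV, w, hw, hm⟩ := (isSolution_iff hμ (ha.1.trans_le ha.2) 0).1 h
  exact (isSolution_iff hμ ha.1 0).2 ⟨hx, fun t ht => hV t ⟨ht.1, ht.2.trans ha.2⟩, w,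
    fun t ht => hw t ⟨ht.1, ht.2.trans ha.2⟩, hm.mono ha.2⟩

lemma shift (hμ : μ ∈ Ioo 0 1) (h : IsSolution i μ V A F₁ F₂ T x u) (ha : a ∈ Ioo 0 T) :
    IsSolution i μ V A F₁ F₂ (T - a) (u a) (fun s => u (a + s)) := by
  obtain ⟨-, hV, w, hw, hm⟩ := (isSolution_iff hμ (ha.1.trans ha.2) 0).1 h
  refine (isSolution_iff hμ (sub_pos.2 ha.2) 0).2 ⟨by rw [add_zero], fun t ht => ?_,
    fun s => w (a + s), fun t ht => ?_, ?_⟩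
  · exact hV _ ⟨by linarith [ha.1, ht.1], by linarith [ht.2]⟩
  · exact hw _ ⟨by linarith [ha.1, ht.1], by linarith [ht.2]⟩
  · rw [hw a ⟨ha.1, ha.2.le⟩, map_add, add_sub_cancel_left]
    exact hm.shift hμ ha.1 ha.2

lemma glue (hi : Function.Injective i) (hμ : μ ∈ Ioo 0 1) {b : ℝ} (hab : a ∈ Ioo 0 b) (haT : a < T)
    (h : IsSolution i μ V A F₁ F₂ b x u) (h' : IsSolution i μ V A F₁ F₂ (T - a) (u a) u')
    (heq : ∀ᶠ s in 𝓝[>] 0, u' s = u (a + s)) :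
    IsSolution i μ V A F₁ F₂ T x (fun t => if t ≤ a then u t else u' (t - a)) := by
  have hb : 0 < b := hab.1.trans hab.2
  have hTa : 0 < T - a := sub_pos.2 haT
  obtain ⟨hx, hV, w, hw, hm⟩ := (isSolution_iff hμ hb 0).1 h
  obtain ⟨-, hV', w', hw', hm'⟩ := (isSolution_iff hμ hTa 0).1 h'
  rw [hw a ⟨hab.1, hab.2.le⟩, map_add, add_sub_cancel_left] at hm'
  have hww' : (fun s => w (a + s)) =ᶠ[𝓝[>] 0] w' := by
    filter_upwards [heq, Ioc_mem_nhdsGT hTa, Ioc_mem_nhdsGT (sub_pos.2 hab.2)] with s hs hsT hsb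
    rw [hw' s hsT, hw _ ⟨by linarith [hab.1, hsb.1], by linarith [hsb.2]⟩] at hs
    exact (add_left_cancel (hi hs)).symm
  have hglue := (hm.mono hab.2.le).glue hμ hab.1 haT hm' ((hm.bc.tendsto_add_left hab).congr' hww')
    ((hm.bc_rhs.tendsto_add_left hab).congr' (hww'.fun_comp _))
  refine (isSolution_iff hμ (hab.1.trans haT) 0).2 ⟨by simpa [hab.1.le] using hx, fun t ht => ?_,
    _, fun t ht => ?_, hglue.congr (hab.1.trans haT) (fun t _ => apply_ite _ _ _ _)
      fun _ _ => rfl⟩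
  · split_ifs with hta
    · exact hV t ⟨ht.1, hta.trans hab.2.le⟩
    · exact hV' _ ⟨by linarith, by linarith [ht.2]⟩
  · split_ifs with hta
    · exact hw t ⟨ht.1, hta.trans hab.2.le⟩
    · exact hw' _ ⟨by linarith, by linarith [ht.2]⟩

end IsSolution

end Solutions

section LocalConstants

variable {E₀ E₁ : Type*} [NormedAddCommGroup E₀] [NormedSpace ℝ E₀]
  [NormedAddCommGroup E₁] [NormedSpace ℝ E₁] {i B : E₁ →L[ℝ] E₀} {μ β ν C C' ε T : ℝ} {V : Set E₀}
  {A : E₀ → E₁ →L[ℝ] E₀} {F₁ F₂ : E₀ → E₀} {y : E₁}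

lemma LinearEstimate.mono (h : LinearEstimate i μ B ν C T) (hC : C ≤ C') (hε : ε ≤ T) :
    LinearEstimate i μ B ν C' ε := fun τ hτ x hx g v hv G hG t ht => by
  have := add_nonneg (interpNorm_nonneg (i := i) (θ := ν) x) (hG.nonneg hτ.1)
  exact (h τ ⟨hτ.1, hτ.2.trans hε⟩ x hx g v hv G hG t ht).trans (by gcongr)

lemma MildSolvable.exists_linearEstimate [CompleteSpace E₀] [CompleteSpace E₁]
    (hi : Function.Injective i) (hμ : μ ∈ Ioo 0 1) (hT : 0 < T) (h : MildSolvable i μ T B)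
    (hν : ν ∈ Ioo 0 1) : ∃ C > 0, LinearEstimate i μ B ν C T := by
  obtain ⟨C, hC, hest⟩ := h.exists_estimate hi hμ hT hν
  refine ⟨C, hC, fun τ hτ x hx g v hv G hG t ht => ?_⟩
  obtain ⟨hbound, htrace⟩ := hest τ hτ x hx g v hv G hG
  exact max_le (hbound t ht) (htrace t ht)

lemma tendsto_mul_add_rpow {θ : ℝ} (hθ : θ < 1) (K : ℝ) :
    Tendsto (fun r : ℝ => K * (r + r ^ (1 - θ))) (𝓝[>] 0) (𝓝 0) := by
  have hcont : Continuous fun r : ℝ => K * (r + r ^ (1 - θ)) :=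
    continuous_const.mul (continuous_id.add (Real.continuous_rpow_const (by linarith)))
  simpa [Real.zero_rpow (sub_pos.2 hθ).ne'] using
    (hcont.tendsto 0).mono_left (nhdsWithin_le_nhds (s := Ioi 0))

lemma eventually_apply_add_mem (hμ : μ < 1) (hV : IsOpenInInterp i μ V) (hy : i y ∈ V) :
    ∀ᶠ ε in 𝓝[>] (0 : ℝ), ∀ w, interpNorm i μ (i w) ≤ ε → i (y + w) ∈ V := by
  obtain ⟨r, hr, hball⟩ := hV.2 _ hy
  filter_upwards [Ioo_mem_nhdsGT hr] with ε hε w hw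
  refine hball _ (apply_mem_interpSpace hμ _) ?_
  rw [map_add, add_sub_cancel_left]
  exact hw.trans_lt hε.2

lemma eventually_remainder_lipschitz (hμ : μ ∈ Ioo 0 1) (hV : IsOpenInInterp i μ V)
    (hH1 : HypH1 i μ V A F₁) (hH2 : HypH2 i μ V F₂ β) (hy : i y ∈ V) {c : ℝ} (hc : 0 < c) :
    ∀ᶠ ε in 𝓝[>] (0 : ℝ), ∀ t ∈ Ioc 0 ε, ∀ w₁ w₂,
      weightedNorm i μ t w₁ ≤ ε → weightedNorm i μ t w₂ ≤ ε →
      t ^ (1 - μ) * ‖remainder i A F₁ F₂ y w₁ - remainder i A F₁ F₂ y w₂‖ ≤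
        c * weightedNorm i μ t (w₁ - w₂) := by
  obtain ⟨K, hK, r₀, hr₀, hlip⟩ := exists_rpow_mul_norm_remainder_sub_le hμ hV hH1 hH2 hy
  filter_upwards [(tendsto_mul_add_rpow hH2.1.2 K).eventually_le_const hc, Ioc_mem_nhdsGT hr₀.1]
    with ε hεc hε t ht w₁ w₂ hw₁ hw₂
  have hε0 := hε.1
  have hD := weightedNorm_nonneg (i := i) (μ := μ) (t := t) (w₁ - w₂)
  obtain ⟨hw₁t, hw₁⟩ := max_le_iff.1 hw₁
  obtain ⟨hw₂t, hw₂⟩ := max_le_iff.1 hw₂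
  calc _ ≤ K * (ε * (t ^ (1 - μ) * ‖w₁ - w₂‖) + ε ^ (1 - β) * weightedNorm i μ t (w₁ - w₂)) :=
        hlip ε (hε.2.trans hr₀.2) t ht ε hε.2 w₁ w₂ hw₁ hw₂ hw₁t hw₂t
    _ ≤ K * (ε * weightedNorm i μ t (w₁ - w₂) + ε ^ (1 - β) * weightedNorm i μ t (w₁ - w₂)) := by
        gcongr
        exact rpow_mul_norm_le_weightedNorm _
    _ = K * (ε + ε ^ (1 - β)) * weightedNorm i μ t (w₁ - w₂) := by ring
    _ ≤ c * weightedNorm i μ t (w₁ - w₂) := by gcongr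

lemma eventually_remainder_vanishing (hμ : μ ∈ Ioo 0 1) (hV : IsOpenInInterp i μ V)
    (hH1 : HypH1 i μ V A F₁) (hH2 : HypH2 i μ V F₂ β) (hy : IsEquilibrium i V A F₁ F₂ y) :
    ∀ᶠ ε in 𝓝[>] (0 : ℝ), ∀ w : ℝ → E₁, IsBC μ ε w →
      (∀ t ∈ Ioc 0 ε, weightedNorm i μ t (w t) ≤ ε) →
      Tendsto (fun t => ‖t ^ (1 - μ) • remainder i A F₁ F₂ y (w t)‖) (𝓝[>] 0) (𝓝 0) := by
  obtain ⟨K, hK, r₀, hr₀, hlip⟩ := exists_rpow_mul_norm_remainder_sub_le hμ hV hH1 hH2 hy.1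
  filter_upwards [Ioc_mem_nhdsGT hr₀.1] with ε hε w hw hwε
  -- The estimate is applied at each time `t` with the smallest admissible `a`, which tends to `0`.
  set a : ℝ → ℝ := fun t => max t ‖t ^ (1 - μ) • w t‖
  have ha_lim : Tendsto a (𝓝[>] 0) (𝓝 0) := by
    simpa using (tendsto_id.mono_left nhdsWithin_le_nhds).max hw.vanishing
  have hrpow_lim : Tendsto (fun t => a t ^ (1 - β)) (𝓝[>] 0) (𝓝 0) := by
    have h := ha_lim.rpow_const (p := 1 - β) (.inr (by linarith [hH2.1.2]))
    rwa [Real.zero_rpow (sub_pos.2 hH2.1.2).ne'] at h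
  have hlim : Tendsto (fun t => K * (ε * ‖t ^ (1 - μ) • w t‖ + a t ^ (1 - β) * ε))
      (𝓝[>] 0) (𝓝 0) := by
    simpa using ((hw.vanishing.const_mul ε).add (hrpow_lim.mul_const ε)).const_mul K
  refine squeeze_zero' (.of_forall fun _ => norm_nonneg _) ?_ hlim
  filter_upwards [ha_lim.eventually_le_const one_pos, Ioc_mem_nhdsGT hε.1] with t hat ht
  have ha0 : 0 < a t := ht.1.trans_le (le_max_left _ _)
  have hwt := (max_le_iff.1 (hwε t ht)).2
  have h := hlip (a t) hat t ⟨ht.1, le_max_left _ _⟩ ε hε.2 (w t) 0 hwt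
    (by simpa [interpNorm_zero] using hε.1.le)
    ((norm_rpow_smul ht.1.le _ _).symm.trans_le (le_max_right _ _)) (by simpa using ha0.le)
  rw [hy.remainder_zero, sub_zero, sub_zero, ← norm_rpow_smul ht.1.le,
    ← norm_rpow_smul ht.1.le] at h
  exact h.trans (by gcongr; exact hwε t ht)

lemma eventually_remainder_subcritical (hμ : μ ∈ Ioo 0 1) (hV : IsOpenInInterp i μ V)
    (hH1 : HypH1 i μ V A F₁) (hH2 : HypH2 i μ V F₂ β) (hy : IsEquilibrium i V A F₁ F₂ y)
    (hν : ν ∈ Ico β 1) {c : ℝ} (hc : 0 < c) :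
    ∀ᶠ ε in 𝓝[>] (0 : ℝ), ∀ t ∈ Ioc 0 ε, ∀ w,
      weightedNorm i μ t w ≤ ε → weightedNorm i ν t w ≤ ε →
      t ^ (1 - ν) * ‖remainder i A F₁ F₂ y w‖ ≤ c * weightedNorm i ν t w := by
  obtain ⟨K, hK, r₀, hr₀, hbound⟩ := exists_rpow_mul_norm_remainder_le hμ hV hH1 hH2 hy hν
  filter_upwards [(tendsto_mul_add_rpow hν.2 K).eventually_le_const hc, Ioc_mem_nhdsGT hr₀.1]
    with ε hεc hε t ht w hwμ hwν
  have ht0 := ht.1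
  have hD := weightedNorm_nonneg (i := i) (μ := ν) (t := t) w
  have hexp : 0 ≤ 1 - ν := sub_nonneg.2 hν.2.le
  calc _ ≤ K * (ε + t ^ (1 - ν)) * weightedNorm i ν t w :=
        hbound t ht0 ε hε.2 w (max_le_iff.1 hwμ).2
          ((max_le_iff.1 hwν).2.trans (hε.2.trans hr₀.2))
    _ ≤ K * (ε + ε ^ (1 - ν)) * weightedNorm i ν t w := by
        gcongr
        exact ht.2
    _ ≤ c * weightedNorm i ν t w := by gcongr

lemma exists_isContractive_isSubcritical [CompleteSpace E₀] [CompleteSpace E₁]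
    (hi : Function.Injective i) (hμ : μ ∈ Ioo 0 1) (hV : IsOpenInInterp i μ V)
    (hH1 : HypH1 i μ V A F₁) (hH2 : HypH2 i μ V F₂ β) (hy : IsEquilibrium i V A F₁ F₂ y)
    (hν : ν ∈ Ico β 1) :
    ∃ C ε, IsContractive i μ (A (i y)) C ε (remainder i A F₁ F₂ y) ∧
      IsSubcritical i μ ν (A (i y)) C ε (remainder i A F₁ F₂ y) ∧
      ∀ w, interpNorm i μ (i w) ≤ ε → i (y + w) ∈ V := by
  have hν' : ν ∈ Ioo 0 1 := ⟨hμ.1.trans (hH2.1.1.trans_le hν.1), hν.2⟩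
  obtain ⟨T, hT, hsolv⟩ := exists_mildSolvable hi hμ (hH1.maxReg _ hy.1)
  obtain ⟨Cμ, hCμ, hestμ⟩ := hsolv.exists_linearEstimate hi hμ hT hμ
  obtain ⟨Cν, -, hestν⟩ := hsolv.exists_linearEstimate hi hμ hT hν'
  set C := max Cμ Cν
  have hC : 0 < C := lt_max_of_lt_left hCμ
  have hc : 0 < 1 / (4 * C) := by positivity
  obtain ⟨ε, hmem, hlip, hvan, hsub, hε⟩ := ((eventually_apply_add_mem hμ.2 hV hy.1).and
    ((eventually_remainder_lipschitz hμ hV hH1 hH2 hy.1 hc).and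
    ((eventually_remainder_vanishing hμ hV hH1 hH2 hy).and
    ((eventually_remainder_subcritical hμ hV hH1 hH2 hy hν hc).and
    (Ioc_mem_nhdsGT hT))))).exists
  simp only [one_div_mul_eq_div] at hlip hsub
  exact ⟨C, ε,
    { C_pos := hC
      ε_pos := hε.1
      exists_sol := fun x hx g hg => hsolv.exists_sol_of_le hμ.2 hε hx hg
      linear := hestμ.mono (le_max_left _ _) hε.2
      zero := hy.remainder_zero
      lipschitz := hlip
      vanishing := hvan },
    ⟨hestν.mono (le_max_right _ _) hε.2, hsub⟩, hmem⟩

end LocalConstants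

/-! ### Equivalence of the stability notions -/

lemma eventually_mul_lt (c : ℝ) {d : ℝ} (hd : 0 < d) : ∀ᶠ r in 𝓝[>] 0, c * r < d := by
  have hlim : Tendsto (fun r => c * r) (𝓝 0) (𝓝 0) := by
    simpa using (continuous_const_mul c).tendsto 0
  exact (hlim.mono_left nhdsWithin_le_nhds).eventually_lt_const hd

section Stability

variable {E₀ E₁ : Type*} [NormedAddCommGroup E₀] [NormedSpace ℝ E₀] [CompleteSpace E₀]
  [NormedAddCommGroup E₁] [NormedSpace ℝ E₁] {i : E₁ →L[ℝ] E₀} {μ β ν θ C ε T a R t : ℝ}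
  {V : Set E₀} {A : E₀ → E₁ →L[ℝ] E₀} {F₁ F₂ : E₀ → E₀} {y : E₁} {x : E₀} {u u' : ℝ → E₀}

namespace IsSolution

lemma mem_interpSpace (hμ : μ ∈ Ioo 0 1) (hθ : θ < 1) (hu : IsSolution i μ V A F₁ F₂ T x u)
    (ht : t ∈ Ioc 0 T) : u t ∈ interpSpace i θ := by
  obtain ⟨-, -, w, hw, -⟩ := (isSolution_iff hμ (ht.1.trans_le ht.2) 0).1 hu
  exact hw t ht ▸ apply_mem_interpSpace hθ _

lemma eqOn (hμ : μ ∈ Ioo 0 1) (h : IsContractive i μ (A (i y)) C ε (remainder i A F₁ F₂ y))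
    (hT : T ∈ Ioc 0 ε) (hx : x ∈ interpSpace i μ) (hxε : 4 * C * interpNorm i μ (x - i y) ≤ ε)
    (hu : IsSolution i μ V A F₁ F₂ T x u) (hu' : IsSolution i μ V A F₁ F₂ T x u') :
    EqOn u u' (Ioc 0 T) := fun t ht => by
  obtain ⟨-, -, w, hw, hm⟩ := (isSolution_iff hμ hT.1 y).1 hu
  obtain ⟨-, -, w', hw', hm'⟩ := (isSolution_iff hμ hT.1 y).1 hu'
  rw [hw t ht, hw' t ht,
    h.eqOn hμ hT (sub_mem_interpSpace hx (apply_mem_interpSpace hμ.2 y)) hxε hm hm' ht]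

/-- With `θ > μ` this is the parabolic smoothing of solutions starting near the equilibrium in
`E_μ`. -/
lemma interpNorm_sub_le (hμ : μ ∈ Ioo 0 1)
    (h : IsContractive i μ (A (i y)) C ε (remainder i A F₁ F₂ y)) (hθ : θ ∈ Ico μ 1)
    (hu : IsSolution i μ V A F₁ F₂ T x u) (hx : x ∈ interpSpace i μ) (hR : R ∈ Ioc 0 ε)
    (hxR : 4 * C * interpNorm i μ (x - i y) ≤ R) (ht : t ∈ Ioc 0 T) (htε : t ≤ ε) :
    interpNorm i θ (u t - i y) ≤ t ^ (μ - θ) * R := by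
  obtain ⟨-, -, w, hw, hm⟩ := (isSolution_iff hμ (ht.1.trans_le ht.2) y).1 hu
  have ht0 := ht.1
  have hwR := h.weightedNorm_le ⟨hμ.1.le, hμ.2⟩ ⟨ht.1, htε⟩
    (sub_mem_interpSpace hx (apply_mem_interpSpace hμ.2 y)) (hm.mono ht.2) hR hxR t ⟨ht.1, le_rfl⟩
  rw [hw t ht, map_add, add_sub_cancel_left]
  grw [interpNorm_apply_le_mul_weightedNorm hμ.1.le hθ ht.1, hwR]

lemma interpNorm_sub_le_of_lt (hμ : μ ∈ Ioo 0 1)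
    (h : IsContractive i μ (A (i y)) C ε (remainder i A F₁ F₂ y)) (hθ : θ ∈ Ico μ 1)
    (hu : IsSolution i μ V A F₁ F₂ T x u) (ht : t ∈ Ioc ε T) (hR : R ∈ Ioc 0 ε)
    (hutR : 4 * C * interpNorm i μ (u (t - ε) - i y) ≤ R) :
    interpNorm i θ (u t - i y) ≤ ε ^ (μ - θ) * R := by
  have ha : t - ε ∈ Ioo 0 T := ⟨sub_pos.2 ht.1, by linarith [ht.2, h.ε_pos]⟩
  have hsmooth := (hu.shift hμ ha).interpNorm_sub_le hμ h hθ
    (hu.mem_interpSpace hμ hμ.2 ⟨ha.1, ha.2.le⟩) hR hutR (t := ε)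
    ⟨h.ε_pos, by linarith [ht.2]⟩ le_rfl
  rwa [sub_add_cancel] at hsmooth

lemma interpNorm_sub_le_self (hμ : μ ∈ Ioo 0 1)
    (h : IsContractive i μ (A (i y)) C ε (remainder i A F₁ F₂ y))
    (hu : IsSolution i μ V A F₁ F₂ T x u) (hx : x ∈ interpSpace i μ) (hR : R ∈ Ioc 0 ε)
    (hxR : 4 * C * interpNorm i μ (x - i y) ≤ R) (ht : t ∈ Ioc 0 T) (htε : t ≤ ε) :
    interpNorm i μ (u t - i y) ≤ R := by
  simpa using hu.interpNorm_sub_le hμ h ⟨le_rfl, hμ.2⟩ hx hR hxR ht htε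

lemma interpNorm_sub_le_of_isSubcritical (hμ : μ ∈ Ioo 0 1)
    (h : IsContractive i μ (A (i y)) C ε (remainder i A F₁ F₂ y))
    (hν : IsSubcritical i μ ν (A (i y)) C ε (remainder i A F₁ F₂ y)) (hμν : ν ∈ Ico μ 1)
    (hu : IsSolution i μ V A F₁ F₂ T x u) (hx : x ∈ interpSpace i ν)
    (hxε : 4 * C * interpNorm i μ (x - i y) ≤ ε) (hR : R ∈ Ioc 0 ε)
    (hxR : 4 * C * interpNorm i ν (x - i y) ≤ R) (ht : t ∈ Ioc 0 T) (htε : t ≤ ε) :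
    interpNorm i ν (u t - i y) ≤ R := by
  have hsub : x - i y ∈ interpSpace i ν := sub_mem_interpSpace hx (apply_mem_interpSpace hμν.2 y)
  have hsub' := interpSpace_anti hμν.1 hsub
  obtain ⟨-, -, w, hw, hm⟩ := (isSolution_iff hμ (ht.1.trans_le ht.2) y).1 hu
  obtain ⟨w', hm', hw'R⟩ := h.exists_solution hμ hν hsub' hxε hsub hR hxR
  rw [hw t ht, map_add, add_sub_cancel_left, h.eqOn hμ ⟨ht.1, htε⟩ hsub' hxε (hm.mono ht.2)
    (hm'.mono htε) ⟨ht.1, le_rfl⟩]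
  exact (interpNorm_le_weightedNorm _).trans (hw'R t ⟨ht.1, htε⟩)

lemma exists_isGlobalSolution (hi : Function.Injective i) (hμ : μ ∈ Ioo 0 1)
    (h : IsContractive i μ (A (i y)) C ε (remainder i A F₁ F₂ y)) (ha : a ∈ Ioo 0 ε)
    (hu : IsSolution i μ V A F₁ F₂ ε x u) (hua : 4 * C * interpNorm i μ (u a - i y) ≤ ε)
    (hu' : IsGlobalSolution i μ V A F₁ F₂ (u a) u') :
    ∃ u, IsGlobalSolution i μ V A F₁ F₂ x u := by
  have haε : 0 < ε - a := sub_pos.2 ha.2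
  have heq : EqOn u' (fun s => u (a + s)) (Ioc 0 (ε - a)) :=
    eqOn hμ h ⟨haε, sub_le_self _ ha.1.le⟩ (hu.mem_interpSpace hμ hμ.2 ⟨ha.1, ha.2.le⟩) hua
      (hu' _ haε) (hu.shift hμ ha)
  refine ⟨fun t => if t ≤ a then u t else u' (t - a), fun T hT => ?_⟩
  have haT : a < max T ε := ha.2.trans_le (le_max_right _ _)
  have hglue := hu.glue hi hμ ha haT (hu' _ (sub_pos.2 haT))
    (by filter_upwards [Ioc_mem_nhdsGT haε] with s hs using heq hs)
  exact hglue.mono hμ ⟨hT, le_max_left _ _⟩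

end IsSolution

lemma IsContractive.exists_isSolution (hμ : μ ∈ Ioo 0 1)
    (h : IsContractive i μ (A (i y)) C ε (remainder i A F₁ F₂ y))
    (hmem : ∀ w, interpNorm i μ (i w) ≤ ε → i (y + w) ∈ V) (hxV : x ∈ V)
    (hx : x ∈ interpSpace i μ) (hxε : 4 * C * interpNorm i μ (x - i y) ≤ ε) :
    ∃ u, IsSolution i μ V A F₁ F₂ ε x u := by
  have hsub := sub_mem_interpSpace hx (apply_mem_interpSpace hμ.2 y)
  obtain ⟨w, hm, hwε⟩ := h.exists_solution hμ h.isSubcritical hsub hxε hsub ⟨h.ε_pos, le_rfl⟩ hxε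
  refine ⟨fun t => if t ≤ 0 then x else i (y + w t), (isSolution_iff hμ h.ε_pos y).2
    ⟨if_pos le_rfl, fun t ht => ?_, w, fun t ht => if_neg ht.1.not_ge, hm⟩⟩
  split_ifs with ht0
  · exact hxV
  · exact hmem _ ((interpNorm_le_weightedNorm _).trans (hwε t ⟨not_le.1 ht0, ht.2⟩))

lemma isStableIn_of_forall_Ioc (hμ : μ ∈ Ioo 0 1) (hθ : θ < 1)
    (h : ∀ κ > 0, ∃ δ ∈ Ioc 0 κ, ∀ x ∈ interpSpace i θ, interpNorm i θ (x - i y) < δ →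
      (∃ u, IsGlobalSolution i μ V A F₁ F₂ x u) ∧
      ∀ T > 0, ∀ u, IsSolution i μ V A F₁ F₂ T x u →
        ∀ t ∈ Ioc 0 T, interpNorm i θ (u t - i y) < κ) :
    IsStableIn i μ V A F₁ F₂ θ (i y) := fun κ hκ => by
  obtain ⟨δ, hδ, h⟩ := h κ hκ
  refine ⟨δ, hδ.1, fun x hx hxδ => ⟨(h x hx hxδ).1, fun T hT u hu t ht => ?_⟩⟩
  rcases ht.1.eq_or_lt with rfl | ht0
  · rw [((isSolution_iff hμ hT 0).1 hu).1]
    exact ⟨hx, hxδ.trans_le hδ.2⟩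
  · exact ⟨hu.mem_interpSpace hμ hθ ⟨ht0, ht.2⟩, (h x hx hxδ).2 T hT u hu t ⟨ht0, ht.2⟩⟩

variable [CompleteSpace E₁]

lemma IsStableIn.of_le (hi : Function.Injective i) (hμ : μ ∈ Ioo 0 1)
    (hV : IsOpenInInterp i μ V) (hH1 : HypH1 i μ V A F₁) (hH2 : HypH2 i μ V F₂ β)
    (hν : ν ∈ Ico β 1) (hy : IsEquilibrium i V A F₁ F₂ y)
    (h : IsStableIn i μ V A F₁ F₂ μ (i y)) : IsStableIn i μ V A F₁ F₂ ν (i y) := by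
  have hμν : ν ∈ Ico μ 1 := ⟨hH2.1.1.le.trans hν.1, hν.2⟩
  obtain ⟨C, ε, hc, hsub, -⟩ := exists_isContractive_isSubcritical hi hμ hV hH1 hH2 hy hν
  have hC := hc.C_pos
  set e := max 1 ‖i‖
  refine isStableIn_of_forall_Ioc hμ hν.2 fun κ hκ => ?_
  obtain ⟨R, hRκ', hR, hRεκ⟩ := ((eventually_mul_lt (ε ^ (μ - ν)) hκ).and
    (Ioo_mem_nhdsGT (lt_min hc.ε_pos hκ))).exists
  obtain ⟨hRε, hRκ⟩ := lt_min_iff.1 hRεκ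
  obtain ⟨δμ, hδμ, hstable⟩ := h (R / (4 * C)) (by positivity)
  obtain ⟨δ, ⟨hδμ', hδε, hδR⟩, hδ⟩ := (((eventually_mul_lt e hδμ).and
    ((eventually_mul_lt (4 * C * e) hc.ε_pos).and (eventually_mul_lt (4 * C) hR))).and
    (Ioc_mem_nhdsGT hκ)).exists
  refine ⟨δ, hδ, fun x hx hxδ => ?_⟩
  have hxδμ : interpNorm i μ (x - i y) ≤ e * δ := by
    grw [interpNorm_le_mul_interpNorm hμ.1.le hμν.1
      (sub_mem_interpSpace hx (apply_mem_interpSpace hν.2 y)), hxδ]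
  obtain ⟨hglobal, hbound⟩ := hstable x (interpSpace_anti hμν.1 hx) (hxδμ.trans_lt hδμ')
  refine ⟨hglobal, fun T hT u hu t ht => ?_⟩
  rcases le_or_gt t ε with htε | hεt
  · refine (hu.interpNorm_sub_le_of_isSubcritical hμ hc hsub hμν hx ?_ ⟨hR, hRε.le⟩ ?_ ht
      htε).trans_lt hRκ
    · grw [hxδμ, ← mul_assoc, hδε]
    · grw [hxδ, hδR]
  · have hut := (hbound T hT u hu (t - ε) ⟨by linarith, by linarith [ht.2, hc.ε_pos]⟩).2
    exact (hu.interpNorm_sub_le_of_lt hμ hc hμν ⟨hεt, ht.2⟩ ⟨hR, hRε.le⟩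
      ((lt_div_iff₀' (by positivity)).1 hut).le).trans_lt hRκ'

lemma IsStableIn.of_ge (hi : Function.Injective i) (hμ : μ ∈ Ioo 0 1)
    (hV : IsOpenInInterp i μ V) (hH1 : HypH1 i μ V A F₁) (hH2 : HypH2 i μ V F₂ β)
    (hν : ν ∈ Ico β 1) (hy : IsEquilibrium i V A F₁ F₂ y)
    (h : IsStableIn i μ V A F₁ F₂ ν (i y)) : IsStableIn i μ V A F₁ F₂ μ (i y) := by
  have hμν : ν ∈ Ico μ 1 := ⟨hH2.1.1.le.trans hν.1, hν.2⟩
  obtain ⟨C, ε, hc, -, hmem⟩ := exists_isContractive_isSubcritical hi hμ hV hH1 hH2 hy hν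
  have hC := hc.C_pos
  obtain ⟨rV, hrV, hball⟩ := hV.2 _ hy.1
  set e := max 1 ‖i‖
  obtain ⟨a, ha0, haε⟩ := exists_between hc.ε_pos
  refine isStableIn_of_forall_Ioc hμ hμ.2 fun κ hκ => ?_
  obtain ⟨δν, hδν, hstable⟩ := h (κ / e) (by positivity)
  obtain ⟨R, ⟨hRC, hRν⟩, hR, hRεκ⟩ := (((eventually_mul_lt (4 * C) hc.ε_pos).and
    (eventually_mul_lt (a ^ (μ - ν)) hδν)).and (Ioo_mem_nhdsGT (lt_min hc.ε_pos hκ))).exists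
  obtain ⟨hRε, hRκ⟩ := lt_min_iff.1 hRεκ
  obtain ⟨δ, hδR, hδ⟩ := ((eventually_mul_lt (4 * C) hR).and
    (Ioc_mem_nhdsGT (lt_min hκ hrV))).exists
  obtain ⟨hδκ, hδV⟩ := le_min_iff.1 hδ.2
  refine ⟨δ, ⟨hδ.1, hδκ⟩, fun x hx hxδ => ?_⟩
  have hxR : 4 * C * interpNorm i μ (x - i y) ≤ R := by grw [hxδ, hδR]
  have hstable_a (T : ℝ) (haT : a < T) (u) (hu : IsSolution i μ V A F₁ F₂ T x u) :=
    hstable (u a) (hu.mem_interpSpace hμ hν.2 ⟨ha0, haT.le⟩) ((hu.interpNorm_sub_le hμ hc hμν hx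
      ⟨hR, hRε.le⟩ hxR ⟨ha0, haT.le⟩ haε.le).trans_lt hRν)
  refine ⟨?_, fun T _ u hu t ht => ?_⟩
  · obtain ⟨u, hu⟩ := hc.exists_isSolution hμ hmem (hball x hx (hxδ.trans_le hδV)) hx
      (hxR.trans hRε.le)
    obtain ⟨⟨u', hu'⟩, -⟩ := hstable_a ε haε u hu
    refine hu.exists_isGlobalSolution hi hμ hc ⟨ha0, haε⟩ ?_ hu'
    grw [hu.interpNorm_sub_le_self hμ hc hx ⟨hR, hRε.le⟩ hxR ⟨ha0, haε.le⟩ haε.le, hRC]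
  rcases le_or_gt t ε with htε | hεt
  · exact (hu.interpNorm_sub_le_self hμ hc hx ⟨hR, hRε.le⟩ hxR ht htε).trans_lt hRκ
  · have haT : a < T := haε.trans (hεt.trans_le ht.2)
    obtain ⟨htν, hut⟩ := (hstable_a T haT u hu).2 _ (sub_pos.2 haT) _ (hu.shift hμ ⟨ha0, haT⟩)
      (t - a) ⟨by linarith, by linarith [ht.2]⟩
    rw [add_sub_cancel] at htν hut
    exact (interpNorm_le_mul_interpNorm hμ.1.le hμν.1
      (sub_mem_interpSpace htν (apply_mem_interpSpace hν.2 y))).trans_lt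
        ((lt_div_iff₀' (by positivity)).1 hut)

end Stability

end QuasiPar

theorem proposition3p1_general {E₀ E₁ : Type*}
    [NormedAddCommGroup E₀] [NormedSpace ℝ E₀] [CompleteSpace E₀]
    [NormedAddCommGroup E₁] [NormedSpace ℝ E₁] [CompleteSpace E₁]
    (i : E₁ →L[ℝ] E₀) (hi : Function.Injective i)
    (μ : ℝ) (hμ : μ ∈ Set.Ioo (0 : ℝ) 1)
    (V : Set E₀) (hV : QuasiPar.IsOpenInInterp i μ V)
    (A : E₀ → E₁ →L[ℝ] E₀) (F₁ F₂ : E₀ → E₀)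
    (hH1 : QuasiPar.HypH1 i μ V A F₁)
    (β : ℝ) (hH2 : QuasiPar.HypH2 i μ V F₂ β)
    (μbar : ℝ) (hμbar : μbar ∈ Set.Ico β 1)
    (y : E₁) (hy : QuasiPar.IsEquilibrium i V A F₁ F₂ y) :
    QuasiPar.IsStableIn i μ V A F₁ F₂ μ (i y) ↔
      QuasiPar.IsStableIn i μ V A F₁ F₂ μbar (i y) :=
  ⟨.of_le hi hμ hV hH1 hH2 hμbar hy, .of_ge hi hμ hV hH1 hH2 hμbar hy⟩

theorem proposition3p1 {E₀ E₁ : Type*}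
    [NormedAddCommGroup E₀] [NormedSpace ℝ E₀] [CompleteSpace E₀]
    [NormedAddCommGroup E₁] [NormedSpace ℝ E₁] [CompleteSpace E₁]
    (i : E₁ →L[ℝ] E₀) (hi : Function.Injective i) (hdense : DenseRange i)
    (μ : ℝ) (hμ : μ ∈ Set.Ioo (0 : ℝ) 1)
    (V : Set E₀) (hV : QuasiPar.IsOpenInInterp i μ V)
    (A : E₀ → E₁ →L[ℝ] E₀) (F₁ F₂ : E₀ → E₀)
    (hH1 : QuasiPar.HypH1 i μ V A F₁)
    (β : ℝ) (hH2 : QuasiPar.HypH2 i μ V F₂ β)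
    (μbar : ℝ) (hμbar : μbar ∈ Set.Ico β 1)
    (y : E₁) (hy : QuasiPar.IsEquilibrium i V A F₁ F₂ y) :
    QuasiPar.IsStableIn i μ V A F₁ F₂ μ (i y) ↔
      QuasiPar.IsStableIn i μ V A F₁ F₂ μbar (i y) :=
  proposition3p1_general i hi μ hμ V hV A F₁ F₂ hH1 β hH2 μbar hμbar y hy
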